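/- **Setting.** Consider a finite polygonal mesh of a closed oriented surface without boundary (for instance a sphere), with vertices $j$, edges $e$ and cells $i$; the two end points of an edge are different vertices and its two sides are different cells. The surface is approximated by plane triangles in $\mathbb{R}^3$: each vertex gets a position, each cell a dual vertex, each edge a point on it (where it meets the dual edge), and each cell with $n$ edges is cut into $2n$ non-degenerate plane triangles with corners (dual vertex of the cell, edge point, end point of that edge). Let $\mathbf{k}$ be the unit normal of a triangle given by the orientation, $\mathbf{u}^\perp=\mathbf{k}\times\mathbf{u}$, let $\nabla$, $\nabla\cdot$ be the surface gradient and divergence, and let $\langle\cdot,\cdot\rangle$ be the $L^2$ inner product over the surface. Each edge $e$ has a unit tangent $\mathbf{t}$ and a unit normal $\mathbf{n}$ with $\mathbf{t}=\mathbf{k}\times\mathbf{n}$. Let $(D_1)_{ej}=t_{ej}$, which is $1$ if $\mathbf{t}$ points along $e$ towards $j$, $-1$ if it points away from $j$, and $0$ if $e$ is not incident on $j$; let $(D_2)_{ie}=n_{ei}$, which is $1$ if $\mathbf{n}$ points out of cell $i$, $-1$ if it points into cell $i$, and $0$ otherwise; and let $\overline{D}_2=D_1^T$. **Compound basis functions**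 (P1, RT0 and P0 denote the continuous piecewise linear, lowest order Raviart–Thomas and piecewise constant spaces on the triangles; an *interior* P1 function is one that vanishes on all cell boundaries). * $\alpha_i$ is constant on cell $i$ with $\int_{\text{cell } i}\alpha_i\,dA=1$, and is zero on all other cells. * $\gamma_j$ is the P1 function with $\gamma_j=\delta_{jj'}$ at each vertex $j'$, with constant gradient along each edge, and with $\langle\nabla\gamma_j,\nabla\eta\rangle=0$ for every interior P1 function $\eta$. * $\mathbf{v}_e$ is the RT0 field whose normal component is constant along each edge, with $\int_{\text{edge } e'}\mathbf{v}_e\cdot\mathbf{n}\,dl=\delta_{ee'}$, with $\nabla\cdot\mathbf{v}_e$ constant on each cell, and with $\langle\mathbf{v}_e,\nabla^\perp\eta\rangle=0$ for every interior P1 function $\eta$, where $\nabla^\perp\eta=\mathbf{k}\times\nabla\eta$. **Claim.** Such functions $\gamma_j$ and $\mathbf{v}_e$ exist for all $j$ and $e$. Let $W_{ee'}=-\langle\mathbf{v}_e,\mathbf{v}_{e'}^\perp\rangle$ and $R_{ji}=\langle\gamma_j,\alpha_i\rangle$. Then $W$ is antisymmetric, $$-\overline{D}_2\,W=R\,D_2,$$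 and consequently $\overline{D}_2\,W\,D_1=0$. -/

import Mathlib

open scoped BigOperators

noncomputable section

/-- Euclidean three-space. -/
abbrev Space := EuclideanSpace ℝ (Fin 3)

/-- The cross product on Euclidean three-space. -/
def cross (u v : Space) : Space :=
  WithLp.toLp 2 (crossProduct (WithLp.ofLp u) (WithLp.ofLp v))

/-- A finite polygonal mesh of a closed oriented surface, the surface being approximated by plane
triangular facets.

The combinatorics is a rotation system on the finite type `D` of directed edges ("darts"):
`rev` reverses a dart, and `next` moves to the following dart when the boundary of the cell on the
left of the dart is traversed counterclockwise. The cells are the cycles of `next`, the vertices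
are the cycles of the rotation `next ∘ rev` of the darts leaving a vertex, and the edges are the
pairs `{d, rev d}`. There is no boundary.

The geometry is given by the positions of the primal vertices (`xV`), of one point on each primal
edge, where it meets the dual edge (`xE`), and of the dual vertices, one in each cell (`xC`).
Every cell with `n` edges is thereby cut into `2 n` plane triangles. -/
structure PolygonalMesh (D V E C : Type*) where
  rev : Equiv.Perm D
  next : Equiv.Perm D
  /-- the vertex at which a dart starts -/
  orig : D → V
  /-- the undirected edge of a dart -/
  edge : D → E
  /-- the cell on the left of a dart -/
  cell : D → C
  /-- the dart along which the unit tangent of an edge points -/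
  pos : E → D
  rev_rev : ∀ d, rev (rev d) = d
  rev_ne : ∀ d, rev d ≠ d
  edge_eq_iff : ∀ d d', edge d = edge d' ↔ d' = d ∨ d' = rev d
  edge_pos : ∀ e, edge (pos e) = e
  cell_surjective : Function.Surjective cell
  cell_eq_iff : ∀ d d', cell d = cell d' ↔ next.SameCycle d d'
  orig_surjective : Function.Surjective orig
  orig_eq_iff : ∀ d d', orig d = orig d' ↔ (next * rev).SameCycle d d'
  /-- the two end points of an edge are different vertices -/
  orig_rev_ne : ∀ d, orig (rev d) ≠ orig d
  /-- the two sides of an edge are different cells -/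
  cell_rev_ne : ∀ d, cell (rev d) ≠ cell d
  xV : V → Space
  xE : E → Space
  xC : C → Space
  /-- the triangle with corners dual vertex, start of `d`, edge point of `d` is nondegenerate -/
  nondegenerate₁ : ∀ d, cross (xV (orig d) - xC (cell d)) (xE (edge d) - xC (cell d)) ≠ 0
  /-- the triangle with corners dual vertex, edge point of `d`, end of `d` is nondegenerate -/
  nondegenerate₂ : ∀ d,
    cross (xE (edge d) - xC (cell d)) (xV (orig (rev d)) - xC (cell d)) ≠ 0

namespace PolygonalMesh

variable {D V E C : Type*}

/-! ### The supermesh of triangular subelements -/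

/-- The position of a node of the supermesh: a primal vertex, an edge point or a dual vertex. -/
def point (M : PolygonalMesh D V E C) : V ⊕ (E ⊕ C) → Space :=
  Sum.elim M.xV (Sum.elim M.xE M.xC)

/-- The nodes of the triangular subelements, in counterclockwise order. The subelements are indexed
by `D × Bool`; `(d, false)` lies between the dual vertex of the cell of `d` and the first half of
`d`, and `(d, true)` between that dual vertex and the second half of `d`. -/
def node (M : PolygonalMesh D V E C) : D × Bool → Fin 3 → V ⊕ (E ⊕ C)
  | (d, false) =>
      ![Sum.inr (Sum.inr (M.cell d)), Sum.inl (M.orig d), Sum.inr (Sum.inl (M.edge d))]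
  | (d, true) =>
      ![Sum.inr (Sum.inr (M.cell d)), Sum.inr (Sum.inl (M.edge d)), Sum.inl (M.orig (M.rev d))]

/-- The corners of a subelement. -/
def corner (M : PolygonalMesh D V E C) (T : D × Bool) (a : Fin 3) : Space :=
  M.point (M.node T a)

/-- `(p₁ - p₀) × (p₂ - p₀)` for the corners `p₀, p₁, p₂` of a subelement. -/
def areaVector (M : PolygonalMesh D V E C) (T : D × Bool) : Space :=
  cross (M.corner T 1 - M.corner T 0) (M.corner T 2 - M.corner T 0)

/-- The area of a subelement. -/
def area (M : PolygonalMesh D V E C) (T : D × Bool) : ℝ := ‖M.areaVector T‖ / 2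

/-- The unit vertical vector `k` on a subelement: the unit normal for which the corners run
counterclockwise. -/
def vert (M : PolygonalMesh D V E C) (T : D × Bool) : Space :=
  ‖M.areaVector T‖⁻¹ • M.areaVector T

/-- The vector along side `a` of a subelement, the side opposite to corner `a`, in the
counterclockwise direction. -/
def sideVector (M : PolygonalMesh D V E C) (T : D × Bool) (a : Fin 3) : Space :=
  M.corner T (a + 2) - M.corner T (a + 1)

/-- Side `a` of a subelement. -/
def side (M : PolygonalMesh D V E C) (T : D × Bool) (a : Fin 3) : Set Space :=
  segment ℝ (M.corner T (a + 1)) (M.corner T (a + 2))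

/-- The unit vector in the plane of a subelement that is normal to side `a` and points out of the
subelement. -/
def outNormal (M : PolygonalMesh D V E C) (T : D × Bool) (a : Fin 3) : Space :=
  ‖M.sideVector T a‖⁻¹ • cross (M.sideVector T a) (M.vert T)

/-- The side (of the adjacent subelement) to which a side of a subelement is glued. Sides `0` are
the halves of the primal edges. -/
def glue (M : PolygonalMesh D V E C) : D × Bool → Fin 3 → (D × Bool) × Fin 3
  | (d, false), 0 => ((M.rev d, true), 0)
  | (d, true), 0 => ((M.rev d, false), 0)
  | (d, false), 1 => ((d, true), 2)
  | (d, true), 2 => ((d, false), 1)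
  | (d, true), 1 => ((M.next d, false), 2)
  | (d, false), 2 => ((M.next.symm d, true), 1)

/-! ### Fields and integrals

A field is given on each subelement separately, so that it may jump between subelements. On a
subelement it is written as a function on the ambient space, of which only the restriction to the
subelement matters. -/

/-- The integral over a subelement with respect to area, in the parametrization
`p₀ + s (p₁ - p₀) + t (p₂ - p₀)`, `0 ≤ s ≤ 1`, `0 ≤ t ≤ 1 - s`. -/
def triIntegral (M : PolygonalMesh D V E C) (T : D × Bool) (f : Space → ℝ) : ℝ :=
  ‖M.areaVector T‖ * ∫ s in (0 : ℝ)..1, ∫ t in (0 : ℝ)..(1 - s),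
    f (M.corner T 0 + s • (M.corner T 1 - M.corner T 0) + t • (M.corner T 2 - M.corner T 0))

/-- The integral over the whole surface of a scalar field. -/
def integral [Fintype D] (M : PolygonalMesh D V E C) (f : D × Bool → Space → ℝ) : ℝ :=
  ∑ T : D × Bool, M.triIntegral T (f T)

/-- The inner product of scalar fields. -/
def innerScalar [Fintype D] (M : PolygonalMesh D V E C) (f g : D × Bool → Space → ℝ) : ℝ :=
  M.integral fun T x => f T x * g T x

/-- The inner product of vector fields. -/
def innerVector [Fintype D] (M : PolygonalMesh D V E C) (u v : D × Bool → Space → Space) : ℝ :=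
  M.integral fun T x => inner ℝ (u T x) (v T x)

/-- `u^⊥ = k × u`. -/
def perp (M : PolygonalMesh D V E C) (u : D × Bool → Space → Space) : D × Bool → Space → Space :=
  fun T x => cross (M.vert T) (u T x)

/-- The surface gradient: the tangential part of the gradient. -/
def grad (M : PolygonalMesh D V E C) (f : D × Bool → Space → ℝ) : D × Bool → Space → Space :=
  fun T x => gradient (f T) x - inner ℝ (gradient (f T) x) (M.vert T) • M.vert T

/-- The surface divergence: the trace of the derivative over the directions tangential to the
subelement. -/
def div (M : PolygonalMesh D V E C) (u : D × Bool → Space → Space) : D × Bool → Space → ℝ :=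
  fun T x => LinearMap.trace ℝ Space (fderiv ℝ (u T) x : Space →ₗ[ℝ] Space)
    - inner ℝ (fderiv ℝ (u T) x (M.vert T)) (M.vert T)

/-- The integral of the outward normal component of a vector field along a side of a subelement. -/
def sideFlux (M : PolygonalMesh D V E C) (u : D × Bool → Space → Space) (T : D × Bool)
    (a : Fin 3) : ℝ :=
  ‖M.sideVector T a‖ * ∫ t in (0 : ℝ)..1,
    inner ℝ (u T (M.corner T (a + 1) + t • M.sideVector T a)) (M.outNormal T a)

/-- `∫_{edge e} u ⋅ n dl`. The unit normal `n` of an edge points out of the cell on the left of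
the edge, so that the unit tangent is `t = k × n`. -/
def edgeFlux (M : PolygonalMesh D V E C) (u : D × Bool → Space → Space) (e : E) : ℝ :=
  ∑ s : Bool, M.sideFlux u (M.pos e, s) 0

/-! ### The finite element spaces on the subelements -/

/-- `f` is a continuous piecewise linear (P1) field on the supermesh, with the given values at the
nodes. (A piecewise linear field is continuous across all sides if and only if it has a single
value at each node.) -/
def IsP1 (M : PolygonalMesh D V E C) (f : D × Bool → Space → ℝ) (val : V ⊕ (E ⊕ C) → ℝ) : Prop :=
  (∀ T, ∃ (g : Space) (c : ℝ), ∀ x, f T x = inner ℝ g x + c) ∧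
  ∀ T a, f T (M.corner T a) = val (M.node T a)

/-- `f` is a continuous piecewise linear field that vanishes on the boundaries of all cells. -/
def IsInteriorP1 (M : PolygonalMesh D V E C) (f : D × Bool → Space → ℝ) : Prop :=
  ∃ val : V ⊕ (E ⊕ C) → ℝ, M.IsP1 f val ∧
    (∀ j, val (Sum.inl j) = 0) ∧ ∀ e, val (Sum.inr (Sum.inl e)) = 0

/-- `u` is a lowest order Raviart-Thomas (RT0) field on the supermesh: on each subelement a
tangential field `a + b (x - p₀)`, with normal components that match on the common side of any two
adjacent subelements. -/
def IsRT0 (M : PolygonalMesh D V E C) (u : D × Bool → Space → Space) : Prop :=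
  (∀ T, ∃ (a : Space) (b : ℝ), inner ℝ a (M.vert T) = 0 ∧
    ∀ x, u T x = a + b • (x - M.corner T 0)) ∧
  ∀ T a, ∀ x ∈ M.side T a,
    inner ℝ (u T x) (M.outNormal T a) +
      inner ℝ (u (M.glue T a).1 x) (M.outNormal (M.glue T a).1 (M.glue T a).2) = 0

/-! ### The compound basis functions -/

/-- The area of a primal cell. -/
def cellArea [Fintype D] [DecidableEq C] (M : PolygonalMesh D V E C) (i : C) : ℝ :=
  ∑ T : D × Bool, if M.cell T.1 = i then M.area T else 0

/-- The basis function `α_i` of `V₂`: constant on cell `i` with integral `1`, zero elsewhere. -/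
def alpha [Fintype D] [DecidableEq C] (M : PolygonalMesh D V E C) (i : C) :
    D × Bool → Space → ℝ :=
  fun T _ => if M.cell T.1 = i then (M.cellArea i)⁻¹ else 0

/-- `f` is the basis function `γ_j` of `V₀`: continuous and piecewise linear on the subelements,
`1` at vertex `j` and `0` at all other vertices, with constant gradient along each primal edge,
and extended into the cells by discrete harmonic extension (`∇² f = 0` in the interior of each
cell, tested with the P1 functions that vanish on the cell boundaries). -/
def IsGamma [Fintype D] [DecidableEq V] (M : PolygonalMesh D V E C) (j : V)
    (f : D × Bool → Space → ℝ) : Prop :=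
  ∃ val : V ⊕ (E ⊕ C) → ℝ, M.IsP1 f val ∧
    (∀ j', val (Sum.inl j') = if j' = j then 1 else 0) ∧
    (∀ d, ∃ slope : ℝ,
      val (Sum.inr (Sum.inl (M.edge d))) - val (Sum.inl (M.orig d))
        = slope * dist (M.xV (M.orig d)) (M.xE (M.edge d)) ∧
      val (Sum.inl (M.orig (M.rev d))) - val (Sum.inr (Sum.inl (M.edge d)))
        = slope * dist (M.xE (M.edge d)) (M.xV (M.orig (M.rev d)))) ∧
    ∀ g, M.IsInteriorP1 g → M.innerVector (M.grad f) (M.grad g) = 0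

/-- `u` is the basis function `v_e` of `V₁`: an RT0 field on the subelements whose normal component
is constant along each primal edge, with flux `1` through edge `e` and `0` through all other
edges, extended into the cells by discrete harmonic extension (`∇ (∇ ⋅ u) = 0`: the divergence is
constant on each cell; `k ⋅ ∇ × u = 0` in the interior of each cell, tested with the P1 functions
that vanish on the cell boundaries). -/
def IsVelocityBasis [Fintype D] [DecidableEq E] (M : PolygonalMesh D V E C) (e : E)
    (u : D × Bool → Space → Space) : Prop :=
  M.IsRT0 u ∧
  (∀ e', ∃ c : ℝ, ∀ s : Bool, ∀ x ∈ M.side (M.pos e', s) 0,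
    inner ℝ (u (M.pos e', s) x) (M.outNormal (M.pos e', s) 0) = c) ∧
  (∀ e', M.edgeFlux u e' = if e' = e then 1 else 0) ∧
  (∃ δ : C → ℝ, ∀ T x, M.div u T x = δ (M.cell T.1)) ∧
  ∀ g, M.IsInteriorP1 g → M.innerVector u (M.perp (M.grad g)) = 0

/-! ### The matrices -/

/-- `(D₁)_{e j} = t_{e j}`: `1` if the tangent of edge `e` points towards vertex `j`, `-1` if it
points away from `j`, and `0` if `e` is not incident on `j`. -/
def D₁ [DecidableEq V] (M : PolygonalMesh D V E C) : Matrix E V ℝ :=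
  Matrix.of fun e j =>
    if M.orig (M.rev (M.pos e)) = j then 1 else if M.orig (M.pos e) = j then -1 else 0

/-- `(D₂)_{i e} = n_{e i}`: `1` if the normal of edge `e` points out of cell `i`, `-1` if it points
into `i`, and `0` if `e` is not an edge of `i`. -/
def D₂ [DecidableEq C] (M : PolygonalMesh D V E C) : Matrix C E ℝ :=
  Matrix.of fun i e =>
    if M.cell (M.pos e) = i then 1 else if M.cell (M.rev (M.pos e)) = i then -1 else 0

/-- The discrete curl `D̄₂ = D₁ᵀ`. -/
def D₂bar [DecidableEq V] (M : PolygonalMesh D V E C) : Matrix V E ℝ := M.D₁.transpose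

/-- The Coriolis matrix `W_{e e'} = - ⟨v_e, v_{e'}^⊥⟩`. -/
def W [Fintype D] (M : PolygonalMesh D V E C) (v : E → D × Bool → Space → Space) :
    Matrix E E ℝ :=
  Matrix.of fun e e' => -M.innerVector (v e) (M.perp (v e'))

/-- The averaging matrix `R_{j i} = ⟨γ_j, α_i⟩`. -/
def R [Fintype D] [DecidableEq C] (M : PolygonalMesh D V E C)
    (γ : V → D × Bool → Space → ℝ) : Matrix V C ℝ :=
  Matrix.of fun j i => M.innerScalar (γ j) (M.alpha i)

end PolygonalMesh

end

/-!
Every field in the theorem is determined by finitely many fluxes. A tangential Raviart-Thomas field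
is given on each triangle by its three outward fluxes, and `∇^⊥` of a P1 function is the
divergence-free field whose fluxes are the differences of its nodal values. Hence `v_e`, `∇^⊥ γ_j`
and the fields `∇^⊥ η` of the interior P1 functions all lie in one finite-dimensional inner product
space of fluxes, and `v_e` and `∇^⊥ γ_j` in its subspace of *harmonic* fluxes: flux density constant
along the edges, divergence constant on the cells, and orthogonal to every `∇^⊥ η`.

A harmonic flux is determined by its fluxes through the edges: if these vanish, then so does the
divergence, and such a flux is itself some `∇^⊥ η`. The edge fluxes can also be prescribed, because
the flux through the interior sides of a cell solves a difference equation around the dual vertex,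
whose compatibility condition is the divergence theorem on the cell. Comparing edge fluxes gives
`∇^⊥ γ_j = -∑ (D₁)_{ej} v_e` and `∇ ⋅ v_e = ∑ (D₂)_{ie} α_i`, so that integration by parts yields
`-(D₁ᵀ W)_{je} = -⟨∇^⊥ γ_j, v_e^⊥⟩ = -⟨∇γ_j, v_e⟩ = ⟨γ_j, ∇ ⋅ v_e⟩ = (R D₂)_{je}`.
-/

noncomputable section

section VectorAlgebra

theorem inner_eq_coords (u v : Space) : inner ℝ u v = u 0 * v 0 + u 1 * v 1 + u 2 * v 2 := by
  simp [PiLp.inner_apply, Fin.sum_univ_three, mul_comm]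

theorem cross_zero_coord (u v : Space) : cross u v 0 = u 1 * v 2 - u 2 * v 1 := by
  simp [cross, cross_apply]

theorem cross_one_coord (u v : Space) : cross u v 1 = u 2 * v 0 - u 0 * v 2 := by
  simp [cross, cross_apply]

theorem cross_two_coord (u v : Space) : cross u v 2 = u 0 * v 1 - u 1 * v 0 := by
  simp [cross, cross_apply]

theorem space_ext {u v : Space} (h0 : u 0 = v 0) (h1 : u 1 = v 1) (h2 : u 2 = v 2) : u = v := by
  ext i
  fin_cases i
  exacts [h0, h1, h2]

theorem cross_add (u v w : Space) : cross u (v + w) = cross u v + cross u w := by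
  apply space_ext <;>
  · simp only [cross_zero_coord, cross_one_coord, cross_two_coord, PiLp.add_apply]
    ring

theorem cross_smul (c : ℝ) (u v : Space) : cross u (c • v) = c • cross u v := by
  apply space_ext <;>
  · simp only [cross_zero_coord, cross_one_coord, cross_two_coord, PiLp.smul_apply, smul_eq_mul]
    ring

theorem cross_zero (u : Space) : cross u 0 = 0 := by
  apply space_ext <;> simp [cross_zero_coord, cross_one_coord, cross_two_coord]

theorem neg_cross_eq_swap (u v : Space) : -cross u v = cross v u := by
  apply space_ext <;>
  · simp only [cross_zero_coord, cross_one_coord, cross_two_coord, PiLp.neg_apply]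
    ring

theorem inner_cross_swap (k u w : Space) : inner ℝ u (cross k w) = -inner ℝ w (cross k u) := by
  simp only [inner_eq_coords, cross_zero_coord, cross_one_coord, cross_two_coord]
  ring

theorem inner_cross_cyclic (u v w : Space) : inner ℝ u (cross v w) = inner ℝ (cross u v) w := by
  simp only [inner_eq_coords, cross_zero_coord, cross_one_coord, cross_two_coord]
  ring

theorem inner_cross_self_left (u v : Space) : inner ℝ u (cross u v) = 0 := by
  simp only [inner_eq_coords, cross_zero_coord, cross_one_coord, cross_two_coord]
  ring

theorem inner_cross_self_right (u v : Space) : inner ℝ u (cross v u) = 0 := by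
  simp only [inner_eq_coords, cross_zero_coord, cross_one_coord, cross_two_coord]
  ring

theorem inner_cross_cross (k u w : Space) :
    inner ℝ (cross k u) (cross k w) = inner ℝ k k * inner ℝ u w - inner ℝ k u * inner ℝ k w := by
  simp only [inner_eq_coords, cross_zero_coord, cross_one_coord, cross_two_coord]
  ring

theorem cross_cramer_rule (u v w x : Space) :
    inner ℝ (cross u v) w • x =
      inner ℝ x (cross v w) • u + inner ℝ x (cross w u) • v + inner ℝ x (cross u v) • w := by
  apply space_ext <;>
  · simp only [inner_eq_coords, cross_zero_coord, cross_one_coord, cross_two_coord,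
      PiLp.add_apply, PiLp.smul_apply, smul_eq_mul]
    ring

end VectorAlgebra

section ReferenceTriangle

theorem integral_quadratic (a b c r : ℝ) :
    ∫ t in (0 : ℝ)..r, a + b * t + c * t ^ 2 = a * r + b * (r ^ 2 / 2) + c * (r ^ 3 / 3) := by
  rw [intervalIntegral.integral_add, intervalIntegral.integral_add,
    intervalIntegral.integral_const_mul, intervalIntegral.integral_const_mul, integral_id,
    integral_pow, intervalIntegral.integral_const]
  · norm_num only [smul_eq_mul, sub_zero]
    ring
  all_goals exact Continuous.intervalIntegrable (by fun_prop) _ _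

theorem integral_cubic (a b c d r : ℝ) :
    ∫ t in (0 : ℝ)..r, a + b * t + c * t ^ 2 + d * t ^ 3 =
      a * r + b * (r ^ 2 / 2) + c * (r ^ 3 / 3) + d * (r ^ 4 / 4) := by
  rw [intervalIntegral.integral_add, integral_quadratic, intervalIntegral.integral_const_mul,
    integral_pow]
  · norm_num
  all_goals exact Continuous.intervalIntegrable (by fun_prop) _ _

theorem integral_triangle_quadratic (a b c p q r : ℝ) :
    ∫ s in (0 : ℝ)..1, ∫ t in (0 : ℝ)..(1 - s),
        (a + b * s + c * t + p * s ^ 2 + q * (s * t) + r * t ^ 2) =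
      a / 2 + (b + c) / 6 + (p + r) / 12 + q / 24 := by
  have inner_integral (s : ℝ) : ∫ t in (0 : ℝ)..(1 - s),
      (a + b * s + c * t + p * s ^ 2 + q * (s * t) + r * t ^ 2) =
      (a + c / 2 + r / 3) + (b - a + q / 2 - c - r) * s + (p - b + c / 2 - q + r) * s ^ 2 +
        (q / 2 - p - r / 3) * s ^ 3 := by
    have regroup (t : ℝ) : a + b * s + c * t + p * s ^ 2 + q * (s * t) + r * t ^ 2 =
        (a + b * s + p * s ^ 2) + (c + q * s) * t + r * t ^ 2 := by ring
    simp only [regroup, integral_quadratic]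
    ring
  simp only [inner_integral, integral_cubic]
  ring

end ReferenceTriangle

section LinearAlgebra

theorem exists_mem_add_mem_orthogonal {K X : Type*} [Field K] [AddCommGroup X] [Module K X]
    [FiniteDimensional K X] {B : LinearMap.BilinForm K X} (hrefl : B.IsRefl)
    (hdef : ∀ x, B x x = 0 → x = 0) (W : Submodule K X) (x : X) :
    ∃ w ∈ W, x + w ∈ B.orthogonal W := by
  have nondegenerate : (B.restrict W).Nondegenerate :=
    ⟨fun w hw => Subtype.ext (hdef w (hw w)), fun w hw => Subtype.ext (hdef w (hw w))⟩
  have hcompl := LinearMap.BilinForm.isCompl_orthogonal_of_restrict_nondegenerate hrefl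
    nondegenerate
  obtain ⟨w, hw, y, hy, rfl⟩ :=
    Submodule.mem_sup.mp (hcompl.sup_eq_top ▸ Submodule.mem_top (x := x))
  exact ⟨-w, W.neg_mem hw, by rwa [add_comm w y, add_neg_cancel_right]⟩

theorem exists_sub_comp_symm_eq {α : Type*} [Fintype α] (τ : Equiv.Perm α) (h : α → ℝ)
    (hsum : ∀ g : α → ℝ, (∀ a, g (τ a) = g a) → g ⬝ᵥ h = 0) :
    ∃ f : α → ℝ, ∀ a, f a - f (τ.symm a) = h a := by
  let coboundary : (α → ℝ) →ₗ[ℝ] α → ℝ := LinearMap.id - LinearMap.funLeft ℝ ℝ τ.symm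
  obtain ⟨_, ⟨f, rfl⟩, horth⟩ := exists_mem_add_mem_orthogonal (B := dotProductBilin ℝ ℝ)
    (fun x y hxy => (dotProduct_comm y x).trans hxy) (fun x => dotProduct_self_eq_zero.mp)
    (LinearMap.range coboundary) h
  set g := h + coboundary f with hg
  have orthogonal (u : α → ℝ) : coboundary u ⬝ᵥ g = 0 :=
    LinearMap.BilinForm.mem_orthogonal_iff.mp horth _ ⟨u, rfl⟩
  have adjoint (u : α → ℝ) : coboundary u ⬝ᵥ g = u ⬝ᵥ (g - g ∘ τ) := by
    rw [dotProduct_sub, ← comp_equiv_symm_dotProduct, ← sub_dotProduct]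
    rfl
  have invariant : g - g ∘ τ = 0 := by
    rw [← dotProduct_self_eq_zero, ← adjoint, orthogonal]
  have g_eq_zero : g = 0 := by
    rw [← dotProduct_self_eq_zero]
    nth_rw 2 [hg]
    rw [dotProduct_add, hsum g fun a => (congrFun (sub_eq_zero.mp invariant) a).symm,
      dotProduct_comm, orthogonal, add_zero]
  refine ⟨-f, fun a => ?_⟩
  have h_eq : h a + (f a - f (τ.symm a)) = 0 := congrFun g_eq_zero a
  simp only [Pi.neg_apply]
  linarith

theorem apply_eq_of_sameCycle {α β : Type*} {σ : Equiv.Perm α} {f : α → β}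
    (hf : ∀ a, f (σ a) = f a) {a b : α} (hab : σ.SameCycle a b) : f a = f b := by
  obtain ⟨n, rfl⟩ := hab
  induction n using Int.induction_on with
  | zero => simp
  | succ n ih => rw [ih, add_comm, zpow_add, zpow_one, Equiv.Perm.mul_apply, hf]
  | pred n ih =>
    rw [ih, ← hf ((σ ^ (-(n : ℤ) - 1)) a), ← Equiv.Perm.mul_apply, ← zpow_one_add,
      add_sub_cancel]

theorem affineMap_add_smul_add_smul {K X Y : Type*} [Ring K] [AddCommGroup X] [Module K X]
    [AddCommGroup Y] [Module K Y] (L : X →ᵃ[K] Y) (p u v : X) (s t : K) :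
    L (p + s • u + t • v) = L p + s • L.linear u + t • L.linear v := by
  rw [add_comm, ← vadd_eq_add, L.map_vadd, add_comm p, ← vadd_eq_add, L.map_vadd, map_smul,
    map_smul, vadd_eq_add, vadd_eq_add]
  abel

end LinearAlgebra

namespace PolygonalMesh

variable {D V E C : Type*} (M : PolygonalMesh D V E C)

section Geometry

variable (T : D × Bool) (a : Fin 3)

theorem areaVector_ne_zero : M.areaVector T ≠ 0 := by
  obtain ⟨d, _ | _⟩ := T
  exacts [M.nondegenerate₁ d, M.nondegenerate₂ d]

theorem norm_areaVector_pos : 0 < ‖M.areaVector T‖ := norm_pos_iff.mpr (M.areaVector_ne_zero T)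

theorem area_pos : 0 < M.area T := half_pos (M.norm_areaVector_pos T)

theorem norm_areaVector : ‖M.areaVector T‖ = 2 * M.area T := (mul_div_cancel₀ _ two_ne_zero).symm

theorem areaVector_eq_norm_smul_vert : M.areaVector T = ‖M.areaVector T‖ • M.vert T :=
  (smul_inv_smul₀ (M.norm_areaVector_pos T).ne' _).symm

theorem inner_vert_vert : inner ℝ (M.vert T) (M.vert T) = 1 := by
  have h := (M.norm_areaVector_pos T).ne'
  rw [vert, real_inner_smul_left, real_inner_smul_right, real_inner_self_eq_norm_sq]
  field_simp

theorem inner_areaVector_vert : inner ℝ (M.areaVector T) (M.vert T) = ‖M.areaVector T‖ := by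
  rw [areaVector_eq_norm_smul_vert, real_inner_smul_left, inner_vert_vert, mul_one,
    ← areaVector_eq_norm_smul_vert]

theorem cross_sideVector :
    cross (M.corner T (a + 1) - M.corner T a) (M.sideVector T a) = M.areaVector T := by
  fin_cases a <;>
  · simp only [sideVector, areaVector, Fin.reduceFinMk, Fin.reduceAdd, zero_add]
    apply space_ext <;>
    · simp only [cross_zero_coord, cross_one_coord, cross_two_coord, PiLp.sub_apply]
      ring

theorem norm_sideVector_pos : 0 < ‖M.sideVector T a‖ := by
  refine norm_pos_iff.mpr fun h => M.areaVector_ne_zero T ?_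
  rw [← M.cross_sideVector T a, h, cross_zero]

/-- The outward normal of side `a`, with the length of the side. -/
def sideNormal : Space := cross (M.sideVector T a) (M.vert T)

theorem inner_outNormal (w : Space) :
    inner ℝ w (M.outNormal T a) = ‖M.sideVector T a‖⁻¹ * inner ℝ w (M.sideNormal T a) :=
  real_inner_smul_right _ _ _

theorem inner_sideVector_sideNormal :
    inner ℝ (M.sideVector T a) (M.sideNormal T a) = 0 := inner_cross_self_left _ _

theorem inner_corner_sub_corner_sideNormal (b : Fin 3) :
    inner ℝ (M.corner T (a + 1) - M.corner T b) (M.sideNormal T a) =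
      if b = a then ‖M.areaVector T‖ else 0 := by
  have hb : b = a ∨ b = a + 1 ∨ b = a + 2 := by revert a b; decide
  rcases hb with rfl | rfl | rfl
  · rw [if_pos rfl, sideNormal, inner_cross_cyclic, cross_sideVector, inner_areaVector_vert]
  · rw [if_neg (by revert a; decide), sub_self, inner_zero_left]
  · rw [if_neg (by revert a; decide), ← neg_sub, inner_neg_left]
    exact neg_eq_zero.mpr (M.inner_sideVector_sideNormal T a)

theorem inner_corner_sub_corner_vert (b : Fin 3) :
    inner ℝ (M.corner T a - M.corner T b) (M.vert T) = 0 := by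
  have from_zero (c : Fin 3) : inner ℝ (M.corner T c - M.corner T 0) (M.vert T) = 0 := by
    rw [vert, real_inner_smul_right, areaVector]
    fin_cases c
    · simp
    · exact mul_eq_zero_of_right _ (inner_cross_self_left _ _)
    · exact mul_eq_zero_of_right _ (inner_cross_self_right _ _)
  rw [← sub_sub_sub_cancel_right _ _ (M.corner T 0), inner_sub_left, from_zero, from_zero, sub_zero]

theorem sum_sideNormal : ∑ b, M.sideNormal T b = 0 := by
  rw [Fin.sum_univ_three]
  simp only [sideNormal, sideVector, Fin.reduceAdd, zero_add]
  apply space_ext <;>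
  · simp only [cross_zero_coord, cross_one_coord, cross_two_coord, PiLp.add_apply,
      PiLp.sub_apply, PiLp.zero_apply]
    ring

theorem sum_inner_sideNormal_smul {w : Space} (hw : inner ℝ w (M.vert T) = 0) (x : Space) :
    ∑ b, inner ℝ w (M.sideNormal T b) • (x - M.corner T b) = ‖M.areaVector T‖ • w := by
  have base_point : ∑ b, inner ℝ w (M.sideNormal T b) • (x - M.corner T 0) = 0 := by
    rw [← Finset.sum_smul, ← inner_sum, sum_sideNormal, inner_zero_right, zero_smul]
  have hw_area : inner ℝ w (M.areaVector T) = 0 := by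
    rw [areaVector_eq_norm_smul_vert, real_inner_smul_right, hw, mul_zero]
  have cramer := cross_cramer_rule (M.corner T 1 - M.corner T 0) (M.corner T 2 - M.corner T 0)
    (M.vert T) w
  rw [← areaVector, hw_area, zero_smul, add_zero, inner_areaVector_vert] at cramer
  have side_one : cross (M.corner T 2 - M.corner T 0) (M.vert T) = -M.sideNormal T 1 := by
    apply space_ext <;>
    · simp only [sideNormal, sideVector, Fin.reduceAdd, cross_zero_coord, cross_one_coord,
        cross_two_coord, PiLp.neg_apply, PiLp.sub_apply]
      ring
  have side_two : cross (M.vert T) (M.corner T 1 - M.corner T 0) = -M.sideNormal T 2 := by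
    rw [sideNormal, neg_cross_eq_swap]
    rfl
  rw [cramer, side_one, side_two, ← sub_zero (∑ b, _), ← base_point, ← Finset.sum_sub_distrib]
  simp only [← smul_sub, sub_sub_sub_cancel_left, Fin.sum_univ_three, inner_neg_right]
  module

end Geometry

section Quadrature

/-- The midpoint of side `a`. -/
def sideMidpoint (T : D × Bool) (a : Fin 3) : Space :=
  M.corner T (a + 1) + (2⁻¹ : ℝ) • M.sideVector T a

/-- A field that is affine on every subelement, such as a P1 or an RT0 field, in the sense that its
extension to the ambient space is. -/
def IsPiecewiseAffine {F : Type*} [NormedAddCommGroup F] [NormedSpace ℝ F]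
    (u : D × Bool → Space → F) : Prop :=
  ∀ T, ∃ L : Space →ᵃ[ℝ] F, u T = L

variable {F : Type*} [NormedAddCommGroup F] [InnerProductSpace ℝ F]

theorem triIntegral_inner_affineMap (T : D × Bool) (L L' : Space →ᵃ[ℝ] F) :
    M.triIntegral T (fun x => inner ℝ (L x) (L' x)) =
      M.area T / 3 * ∑ a, inner ℝ (L (M.sideMidpoint T a)) (L' (M.sideMidpoint T a)) := by
  set p := M.corner T 0 with hp
  set e₁ := M.corner T 1 - M.corner T 0 with he₁
  set e₂ := M.corner T 2 - M.corner T 0 with he₂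
  have midpoint_zero : M.sideMidpoint T 0 = p + (2⁻¹ : ℝ) • e₁ + (2⁻¹ : ℝ) • e₂ := by
    simp only [sideMidpoint, sideVector, p, e₁, e₂, zero_add]
    module
  have midpoint_one : M.sideMidpoint T 1 = p + (0 : ℝ) • e₁ + (2⁻¹ : ℝ) • e₂ := by
    simp only [sideMidpoint, sideVector, p, e₁, e₂, Fin.reduceAdd]
    module
  have midpoint_two : M.sideMidpoint T 2 = p + (2⁻¹ : ℝ) • e₁ + (0 : ℝ) • e₂ := by
    simp only [sideMidpoint, sideVector, p, e₁, e₂, Fin.reduceAdd]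
    module
  have expand (s t : ℝ) : inner ℝ (L (p + s • e₁ + t • e₂)) (L' (p + s • e₁ + t • e₂)) =
      inner ℝ (L p) (L' p) +
        (inner ℝ (L p) (L'.linear e₁) + inner ℝ (L.linear e₁) (L' p)) * s +
        (inner ℝ (L p) (L'.linear e₂) + inner ℝ (L.linear e₂) (L' p)) * t +
        inner ℝ (L.linear e₁) (L'.linear e₁) * s ^ 2 +
        (inner ℝ (L.linear e₁) (L'.linear e₂) + inner ℝ (L.linear e₂) (L'.linear e₁)) * (s * t) +
        inner ℝ (L.linear e₂) (L'.linear e₂) * t ^ 2 := by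
    simp only [affineMap_add_smul_add_smul, inner_add_left, inner_add_right,
      real_inner_smul_left, real_inner_smul_right]
    ring
  rw [Fin.sum_univ_three, midpoint_zero, midpoint_one, midpoint_two, triIntegral, ← he₁,
    ← he₂, ← hp]
  simp only [expand, integral_triangle_quadratic, norm_areaVector]
  ring

variable [Fintype D]

/-- The edge midpoint rule for the integral of the pointwise inner product of two fields. Being
exact for quadratic functions, it agrees with the `L²` inner product on piecewise affine fields; in
contrast to the latter it is bilinear on all fields. -/
def midpointForm (F : Type*) [NormedAddCommGroup F] [InnerProductSpace ℝ F] :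
    LinearMap.BilinForm ℝ (D × Bool → Space → F) :=
  ∑ T, (M.area T / 3) • ∑ a,
    let eval : (D × Bool → Space → F) →ₗ[ℝ] F :=
      LinearMap.proj (φ := fun _ : Space => F) (M.sideMidpoint T a) ∘ₗ LinearMap.proj T
    (innerₗ F).compl₁₂ eval eval

theorem midpointForm_apply (u w : D × Bool → Space → F) :
    M.midpointForm F u w = ∑ T, M.area T / 3 *
      ∑ a, inner ℝ (u T (M.sideMidpoint T a)) (w T (M.sideMidpoint T a)) := by
  simp [midpointForm, LinearMap.sum_apply]

theorem innerVector_eq_midpointForm {u w : D × Bool → Space → Space} (hu : IsPiecewiseAffine u)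
    (hw : IsPiecewiseAffine w) : M.innerVector u w = M.midpointForm Space u w := by
  rw [midpointForm_apply, innerVector, integral]
  refine Finset.sum_congr rfl fun T _ => ?_
  obtain ⟨⟨L, hL⟩, ⟨L', hL'⟩⟩ := hu T, hw T
  rw [hL, hL', triIntegral_inner_affineMap]

theorem innerScalar_eq_midpointForm {f g : D × Bool → Space → ℝ} (hf : IsPiecewiseAffine f)
    (hg : IsPiecewiseAffine g) : M.innerScalar f g = M.midpointForm ℝ g f := by
  rw [midpointForm_apply, innerScalar, integral]
  refine Finset.sum_congr rfl fun T _ => ?_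
  obtain ⟨⟨L, hL⟩, ⟨L', hL'⟩⟩ := hf T, hg T
  rw [hL, hL', ← triIntegral_inner_affineMap]
  rfl

end Quadrature

section Gluing

theorem orig_next (d : D) : M.orig (M.next d) = M.orig (M.rev d) :=
  ((M.orig_eq_iff _ _).mpr ⟨1, by simp [M.rev_rev]⟩).symm

theorem cell_next (d : D) : M.cell (M.next d) = M.cell d :=
  ((M.cell_eq_iff _ _).mpr ⟨1, by simp⟩).symm

theorem edge_rev (d : D) : M.edge (M.rev d) = M.edge d :=
  ((M.edge_eq_iff _ _).mpr (Or.inr rfl)).symm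

theorem glue_glue (T : D × Bool) (a : Fin 3) :
    M.glue (M.glue T a).1 (M.glue T a).2 = (T, a) := by
  obtain ⟨d, _ | _⟩ := T <;> fin_cases a <;> simp [glue, M.rev_rev]

theorem node_glue_add_one (T : D × Bool) (a : Fin 3) :
    M.node (M.glue T a).1 ((M.glue T a).2 + 1) = M.node T (a + 2) := by
  have orig_rev_next_symm (d : D) : M.orig (M.rev (M.next.symm d)) = M.orig d := by
    rw [← orig_next, Equiv.apply_symm_apply]
  have cell_next_symm (d : D) : M.cell (M.next.symm d) = M.cell d := by
    rw [← cell_next, Equiv.apply_symm_apply]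
  obtain ⟨d, _ | _⟩ := T <;> fin_cases a <;>
    simp [glue, node, M.rev_rev, edge_rev, cell_next, orig_next, orig_rev_next_symm,
      cell_next_symm]

theorem node_glue_add_two (T : D × Bool) (a : Fin 3) :
    M.node (M.glue T a).1 ((M.glue T a).2 + 2) = M.node T (a + 1) := by
  rw [← node_glue_add_one, glue_glue]

theorem sideVector_glue (T : D × Bool) (a : Fin 3) :
    M.sideVector (M.glue T a).1 (M.glue T a).2 = -M.sideVector T a := by
  simp only [sideVector, corner, node_glue_add_one, node_glue_add_two, neg_sub]

theorem side_glue (T : D × Bool) (a : Fin 3) :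
    M.side (M.glue T a).1 (M.glue T a).2 = M.side T a := by
  simp only [side, corner, node_glue_add_one, node_glue_add_two]
  exact segment_symm ℝ _ _

theorem sum_eq_zero_of_glue [Fintype D] {f : D × Bool → Fin 3 → ℝ}
    (hf : ∀ T a, f T a + f (M.glue T a).1 (M.glue T a).2 = 0) : ∑ T, ∑ a, f T a = 0 := by
  rw [← Fintype.sum_prod_type']
  refine Finset.sum_involution (fun p _ => M.glue p.1 p.2) (fun p _ => hf p.1 p.2)
    (fun p _ hp hfix => hp ?_) (fun _ _ => Finset.mem_univ _) fun p _ => M.glue_glue p.1 p.2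
  have := hf p.1 p.2
  rw [hfix] at this
  linarith

/-- The permutation of the subelements that turns each one counterclockwise around the dual vertex
of its cell, onto the next subelement of the cell. -/
def turn : Equiv.Perm (D × Bool) where
  toFun T := (M.glue T 1).1
  invFun T := (M.glue T 2).1
  left_inv := by rintro ⟨d, _ | _⟩ <;> simp [glue]
  right_inv := by rintro ⟨d, _ | _⟩ <;> simp [glue]

theorem glue_one (T : D × Bool) : M.glue T 1 = (M.turn T, 2) := by
  obtain ⟨d, _ | _⟩ := T <;> rfl

theorem glue_two (T : D × Bool) : M.glue T 2 = (M.turn.symm T, 1) := by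
  obtain ⟨d, _ | _⟩ := T <;> rfl

theorem cell_turn (T : D × Bool) : M.cell (M.turn T).1 = M.cell T.1 := by
  obtain ⟨d, _ | _⟩ := T
  exacts [rfl, M.cell_next d]

theorem apply_eq_of_cell_eq {X : Type*} {g : D × Bool → X} (hg : ∀ T, g (M.turn T) = g T)
    {T T' : D × Bool} (h : M.cell T.1 = M.cell T'.1) : g T = g T' := by
  have half (d : D) : ∀ s, g (d, s) = g (d, false)
    | false => rfl
    | true => hg (d, false)
  have next_invariant (d : D) : g (M.next d, false) = g (d, false) :=
    (hg (d, true)).trans (half d true)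
  rw [← Prod.mk.eta (p := T), ← Prod.mk.eta (p := T'), half, half T'.1]
  exact apply_eq_of_sameCycle (f := fun d => g (d, false)) next_invariant ((M.cell_eq_iff _ _).mp h)

theorem exists_eq_comp_cell {g : D × Bool → ℝ} (hg : ∀ T, g (M.turn T) = g T) :
    ∃ g' : C → ℝ, ∀ T, g T = g' (M.cell T.1) :=
  ⟨fun c => g ((M.cell_surjective c).choose, false), fun T =>
    M.apply_eq_of_cell_eq hg (M.cell_surjective (M.cell T.1)).choose_spec.symm⟩

end Gluing

section Incidence

theorem D₂_apply [DecidableEq C] (i : C) (e : E) :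
    M.D₂ i e = (if M.cell (M.pos e) = i then 1 else 0) -
      (if M.cell (M.rev (M.pos e)) = i then 1 else 0) := by
  have := M.cell_rev_ne (M.pos e)
  simp only [D₂, Matrix.of_apply]
  split_ifs <;> simp_all

theorem D₁_apply [DecidableEq V] (e : E) (j : V) :
    M.D₁ e j = (if M.orig (M.rev (M.pos e)) = j then 1 else 0) -
      (if M.orig (M.pos e) = j then 1 else 0) := by
  have := M.orig_rev_ne (M.pos e)
  simp only [D₁, Matrix.of_apply]
  split_ifs <;> simp_all

theorem sum_darts_eq_sum_edges [Fintype D] [Fintype E] (f : D → ℝ) :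
    ∑ d, f d = ∑ e, (f (M.pos e) + f (M.rev (M.pos e))) := by
  classical
  rw [← Finset.sum_fiberwise Finset.univ M.edge f]
  refine Finset.sum_congr rfl fun e _ => ?_
  rw [← Finset.sum_pair (M.rev_ne (M.pos e)).symm]
  refine Finset.sum_congr ?_ fun _ _ => rfl
  ext d
  simp only [Finset.mem_filter, Finset.mem_univ, true_and, Finset.mem_insert, Finset.mem_singleton]
  rw [← M.edge_eq_iff, M.edge_pos, eq_comm]

variable [DecidableEq C]

theorem sum_D₂_mul [Fintype D] [Fintype E] {h : D → ℝ} (hh : ∀ d, h (M.rev d) = -h d) (i : C) :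
    ∑ e, M.D₂ i e * h (M.pos e) = ∑ d with M.cell d = i, h d := by
  rw [Finset.sum_filter, M.sum_darts_eq_sum_edges]
  refine Finset.sum_congr rfl fun e _ => ?_
  rw [D₂_apply, hh]
  split_ifs <;> ring

theorem sum_cell_next [Fintype D] (f : D → ℝ) (i : C) :
    ∑ d with M.cell d = i, f (M.next d) = ∑ d with M.cell d = i, f d :=
  Finset.sum_equiv M.next (by simp [cell_next]) fun _ _ => rfl

theorem D₂_mul_D₁ [Finite D] [Fintype E] [DecidableEq V] : M.D₂ * M.D₁ = 0 := by
  cases nonempty_fintype D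
  ext i j
  let boundary (d : D) : ℝ :=
    (if M.orig (M.rev d) = j then 1 else 0) - (if M.orig d = j then 1 else 0)
  have boundary_rev (d : D) : boundary (M.rev d) = -boundary d := by simp [boundary, M.rev_rev]
  calc (M.D₂ * M.D₁) i j = ∑ e, M.D₂ i e * boundary (M.pos e) := by
        simp only [Matrix.mul_apply, D₁_apply, boundary]
    _ = ∑ d with M.cell d = i, boundary d := M.sum_D₂_mul boundary_rev i
    _ = 0 := by
        simp only [boundary, ← orig_next, Finset.sum_sub_distrib]
        rw [M.sum_cell_next fun d => if M.orig d = j then (1 : ℝ) else 0, sub_self]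

end Incidence

section RaviartThomas

/-- The outward fluxes of a field through the sides of the subelements. -/
abbrev Flux (D : Type*) := D × Bool → Fin 3 → ℝ

/-- The tangential Raviart-Thomas field with given outward fluxes; its normal components match on
common sides only if the fluxes do. -/
def rtField : Flux D →ₗ[ℝ] D × Bool → Space → Space where
  toFun φ T x := ‖M.areaVector T‖⁻¹ • ∑ a, φ T a • (x - M.corner T a)
  map_add' φ ψ := by
    ext T x : 2
    simp only [Pi.add_apply, add_smul, Finset.sum_add_distrib, smul_add]
  map_smul' c φ := by
    ext T x : 2
    simp only [Pi.smul_apply, smul_assoc, ← Finset.smul_sum, RingHom.id_apply]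
    rw [smul_comm]

theorem rtField_apply (φ : Flux D) (T : D × Bool) (x : Space) :
    M.rtField φ T x = ‖M.areaVector T‖⁻¹ • ∑ a, φ T a • (x - M.corner T a) := rfl

theorem rtField_apply_eq_add_smul_sub (φ : Flux D) (T : D × Bool) (x p : Space) :
    M.rtField φ T x = M.rtField φ T p + (‖M.areaVector T‖⁻¹ * ∑ a, φ T a) • (x - p) := by
  rw [rtField_apply, rtField_apply, mul_smul, ← smul_add, Finset.sum_smul,
    ← Finset.sum_add_distrib]
  congr 1
  refine Finset.sum_congr rfl fun a _ => ?_
  module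

theorem isPiecewiseAffine_rtField (φ : Flux D) : IsPiecewiseAffine (M.rtField φ) := fun T =>
  ⟨AffineMap.const ℝ Space (M.rtField φ T 0) +
      (‖M.areaVector T‖⁻¹ * ∑ a, φ T a) • AffineMap.id ℝ Space, funext fun x => by
    simp [M.rtField_apply_eq_add_smul_sub φ T x 0]⟩

theorem inner_rtField_vert (φ : Flux D) (T : D × Bool) (b : Fin 3) :
    inner ℝ (M.rtField φ T (M.corner T b)) (M.vert T) = 0 := by
  simp [rtField_apply, real_inner_smul_left, sum_inner, inner_corner_sub_corner_vert]

theorem inner_rtField_sideNormal (φ : Flux D) (T : D × Bool) (a : Fin 3) (t : ℝ) :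
    inner ℝ (M.rtField φ T (M.corner T (a + 1) + t • M.sideVector T a)) (M.sideNormal T a) =
      φ T a := by
  have on_side (b : Fin 3) :
      inner ℝ (M.corner T (a + 1) + t • M.sideVector T a - M.corner T b) (M.sideNormal T a) =
        if b = a then ‖M.areaVector T‖ else 0 := by
    rw [add_sub_right_comm, inner_add_left, real_inner_smul_left, inner_sideVector_sideNormal,
      inner_corner_sub_corner_sideNormal, mul_zero, add_zero]
  have := (M.norm_areaVector_pos T).ne'
  rw [rtField_apply, real_inner_smul_left, sum_inner]
  simp only [real_inner_smul_left, on_side, mul_ite, mul_zero, Finset.sum_ite_eq',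
    Finset.mem_univ, if_true]
  field_simp

theorem rtField_eq_add_smul_sub {φ : Flux D} {T : D × Bool} {v : Space} {b : ℝ}
    (hv : inner ℝ v (M.vert T) = 0)
    (hφ : ∀ a, φ T a =
      inner ℝ (v + b • (M.corner T (a + 1) - M.corner T 0)) (M.sideNormal T a)) (x : Space) :
    M.rtField φ T x = v + b • (x - M.corner T 0) := by
  have flux_eq (a : Fin 3) : φ T a • (x - M.corner T a) =
      inner ℝ v (M.sideNormal T a) • (x - M.corner T a) +
        if 0 = a then (b * ‖M.areaVector T‖) • (x - M.corner T a) else 0 := by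
    rw [hφ, inner_add_left, real_inner_smul_left, inner_corner_sub_corner_sideNormal, add_smul]
    split_ifs <;> simp
  simp only [rtField_apply, flux_eq, Finset.sum_add_distrib, M.sum_inner_sideNormal_smul T hv,
    Finset.sum_ite_eq, Finset.mem_univ, if_true]
  rw [mul_comm b, mul_smul, ← smul_add, inv_smul_smul₀ (M.norm_areaVector_pos T).ne']

theorem inner_rtField_outNormal (φ : Flux D) {T : D × Bool} {a : Fin 3} {x : Space}
    (hx : x ∈ M.side T a) :
    inner ℝ (M.rtField φ T x) (M.outNormal T a) = φ T a / ‖M.sideVector T a‖ := by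
  rw [side, segment_eq_image'] at hx
  obtain ⟨t, -, rfl⟩ := hx
  rw [inner_outNormal, ← sideVector, inner_rtField_sideNormal, inv_mul_eq_div]

theorem sideFlux_rtField (φ : Flux D) (T : D × Bool) (a : Fin 3) :
    M.sideFlux (M.rtField φ) T a = φ T a := by
  have := (M.norm_sideVector_pos T a).ne'
  simp only [sideFlux, inner_outNormal, inner_rtField_sideNormal,
    intervalIntegral.integral_const, sub_zero, one_smul]
  field_simp

/-- The flux through the edge of a dart, out of the cell on its left. -/
def dartFlux : Flux D →ₗ[ℝ] D → ℝ where
  toFun φ d := φ (d, false) 0 + φ (d, true) 0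
  map_add' φ ψ := by
    ext d
    simp only [Pi.add_apply]
    ring
  map_smul' c φ := by
    ext d
    simp only [Pi.smul_apply, smul_eq_mul, RingHom.id_apply]
    ring

theorem dartFlux_apply (φ : Flux D) (d : D) :
    dartFlux φ d = φ (d, false) 0 + φ (d, true) 0 := rfl

theorem edgeFlux_rtField (φ : Flux D) (e : E) :
    M.edgeFlux (M.rtField φ) e = dartFlux φ (M.pos e) := by
  simp only [edgeFlux, sideFlux_rtField, Fintype.sum_bool, dartFlux_apply, add_comm]

theorem div_rtField (φ : Flux D) (T : D × Bool) (x : Space) :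
    M.div (M.rtField φ) T x = (∑ a, φ T a) / M.area T := by
  set β := ‖M.areaVector T‖⁻¹ * ∑ a, φ T a with hβ
  have hderiv : HasFDerivAt (M.rtField φ T) (β • ContinuousLinearMap.id ℝ Space) x := by
    rw [funext fun y => M.rtField_apply_eq_add_smul_sub φ T y 0]
    exact (((hasFDerivAt_id x).sub_const _).const_smul β).const_add _
  have trace_eq : LinearMap.trace ℝ Space
      ((β • ContinuousLinearMap.id ℝ Space : Space →L[ℝ] Space) : Space →ₗ[ℝ] Space) = β * 3 := by
    rw [ContinuousLinearMap.toLinearMap_smul, map_smul, ContinuousLinearMap.coe_id,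
      LinearMap.trace_id]
    simp
  have vertical_eq : inner ℝ ((β • ContinuousLinearMap.id ℝ Space : Space →L[ℝ] Space) (M.vert T))
      (M.vert T) = β := by
    simp only [smul_apply, ContinuousLinearMap.id_apply]
    rw [real_inner_smul_left, inner_vert_vert, mul_one]
  have := (M.area_pos T).ne'
  rw [div, hderiv.fderiv, trace_eq, vertical_eq, hβ, norm_areaVector]
  field_simp
  ring

theorem isPiecewiseAffine_div_rtField (φ : Flux D) : IsPiecewiseAffine (M.div (M.rtField φ)) :=
  fun T => ⟨AffineMap.const ℝ Space _, funext (M.div_rtField φ T)⟩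

/-- The fluxes that match on the common sides of adjacent subelements. -/
def conformingFlux : Submodule ℝ (Flux D) where
  carrier := {φ | ∀ T a, φ T a + φ (M.glue T a).1 (M.glue T a).2 = 0}
  add_mem' hφ hψ T a := by
    simp only [Pi.add_apply]
    linear_combination hφ T a + hψ T a
  zero_mem' := by simp
  smul_mem' c φ hφ T a := by
    simp only [Pi.smul_apply, smul_eq_mul]
    linear_combination c * hφ T a

theorem isRT0_rtField_iff (φ : Flux D) : M.IsRT0 (M.rtField φ) ↔ φ ∈ M.conformingFlux := by
  have matching {T : D × Bool} {a : Fin 3} {x : Space} (hx : x ∈ M.side T a) :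
      inner ℝ (M.rtField φ T x) (M.outNormal T a) + inner ℝ (M.rtField φ (M.glue T a).1 x)
        (M.outNormal (M.glue T a).1 (M.glue T a).2) =
      (φ T a + φ (M.glue T a).1 (M.glue T a).2) / ‖M.sideVector T a‖ := by
    rw [M.inner_rtField_outNormal φ hx, M.inner_rtField_outNormal φ (by rwa [side_glue]),
      sideVector_glue, norm_neg, add_div]
  constructor
  · intro h T a
    have corner_mem : M.corner T (a + 1) ∈ M.side T a := left_mem_segment ℝ _ _
    have := (matching corner_mem).symm.trans (h.2 T a _ corner_mem)
    exact (div_eq_zero_iff.mp this).resolve_right (M.norm_sideVector_pos T a).ne'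
  · refine fun h => ⟨fun T => ⟨_, _, M.inner_rtField_vert φ T 0, fun x =>
      M.rtField_apply_eq_add_smul_sub φ T x (M.corner T 0)⟩, fun T a x hx => ?_⟩
    rw [matching hx, h T a, zero_div]

theorem IsRT0.exists_eq_rtField {M : PolygonalMesh D V E C} {u : D × Bool → Space → Space}
    (hu : M.IsRT0 u) : ∃ φ ∈ M.conformingFlux, u = M.rtField φ := by
  have hu_eq :
      u = M.rtField fun T a => inner ℝ (u T (M.corner T (a + 1))) (M.sideNormal T a) := by
    funext T x
    obtain ⟨v, b, hv, hb⟩ := hu.1 T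
    rw [M.rtField_eq_add_smul_sub hv (fun a => by rw [hb]), hb]
  exact ⟨_, (M.isRT0_rtField_iff _).mp (hu_eq ▸ hu), hu_eq⟩

end RaviartThomas

section PiecewiseLinear

/-- The piecewise linear field with given values at the nodes, a combination of hat functions. -/
def p1Field (val : V ⊕ (E ⊕ C) → ℝ) : D × Bool → Space → ℝ := fun T x =>
  ‖M.areaVector T‖⁻¹ *
    ∑ a, val (M.node T a) * inner ℝ (M.corner T (a + 1) - x) (M.sideNormal T a)

theorem isP1_p1Field (val : V ⊕ (E ⊕ C) → ℝ) : M.IsP1 (M.p1Field val) val := by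
  constructor
  · intro T
    refine ⟨-(‖M.areaVector T‖⁻¹ • ∑ a, val (M.node T a) • M.sideNormal T a),
      ‖M.areaVector T‖⁻¹ *
        ∑ a, val (M.node T a) * inner ℝ (M.corner T (a + 1)) (M.sideNormal T a), fun x => ?_⟩
    simp only [p1Field, real_inner_comm x, inner_neg_right, real_inner_smul_right, inner_sum,
      inner_sub_left, mul_sub, Finset.sum_sub_distrib]
    ring
  · intro T b
    have := (M.norm_areaVector_pos T).ne'
    simp only [p1Field, inner_corner_sub_corner_sideNormal, mul_ite, mul_zero, Finset.sum_ite_eq,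
      Finset.mem_univ, if_true]
    field_simp

/-- The fluxes of the rotated gradient `∇^⊥` of the piecewise linear field with given values at the
nodes. -/
def curlFlux : (V ⊕ (E ⊕ C) → ℝ) →ₗ[ℝ] Flux D where
  toFun val T a := val (M.node T (a + 1)) - val (M.node T (a + 2))
  map_add' val val' := by
    ext T a
    simp only [Pi.add_apply]
    ring
  map_smul' c val := by
    ext T a
    simp only [Pi.smul_apply, smul_eq_mul, RingHom.id_apply]
    ring

theorem curlFlux_apply (val : V ⊕ (E ⊕ C) → ℝ) (T : D × Bool) (a : Fin 3) :
    M.curlFlux val T a = val (M.node T (a + 1)) - val (M.node T (a + 2)) := rfl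

theorem curlFlux_mem_conformingFlux (val : V ⊕ (E ⊕ C) → ℝ) :
    M.curlFlux val ∈ M.conformingFlux := fun T a => by
  rw [curlFlux_apply, curlFlux_apply, node_glue_add_one, node_glue_add_two]
  ring

theorem sum_curlFlux (val : V ⊕ (E ⊕ C) → ℝ) (T : D × Bool) : ∑ a, M.curlFlux val T a = 0 := by
  simp only [curlFlux_apply, Fin.sum_univ_three, Fin.reduceAdd, zero_add]
  ring

theorem inner_grad_vert (f : D × Bool → Space → ℝ) (T : D × Bool) (x : Space) :
    inner ℝ (M.grad f T x) (M.vert T) = 0 := by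
  rw [grad, inner_sub_left, real_inner_smul_left, inner_vert_vert, mul_one, sub_self]

theorem gradient_inner_add_const (g : Space) (c : ℝ) (x : Space) :
    gradient (fun y => inner ℝ g y + c) x = g :=
  HasGradientAt.gradient <| hasGradientAt_iff_hasFDerivAt.mpr <|
    (InnerProductSpace.toDual ℝ Space g).hasFDerivAt.add_const c

variable {M} {f : D × Bool → Space → ℝ} {val : V ⊕ (E ⊕ C) → ℝ}

theorem IsP1.isPiecewiseAffine (hf : M.IsP1 f val) : IsPiecewiseAffine f := fun T => by
  obtain ⟨g, c, hg⟩ := hf.1 T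
  exact ⟨(innerₗ Space g).toAffineMap + AffineMap.const ℝ Space c, funext hg⟩

theorem IsP1.exists_grad_eq (hf : M.IsP1 f val) (T : D × Bool) :
    ∃ h, (∀ x, M.grad f T x = h) ∧
      ∀ a b, inner ℝ h (M.corner T a - M.corner T b) = val (M.node T a) - val (M.node T b) := by
  obtain ⟨g, c, hg⟩ := hf.1 T
  have gradient_eq (x : Space) : gradient (f T) x = g := by
    rw [funext hg, gradient_inner_add_const]
  refine ⟨g - inner ℝ g (M.vert T) • M.vert T, fun x => by rw [grad, gradient_eq], fun a b => ?_⟩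
  rw [inner_sub_left, real_inner_smul_left, real_inner_comm _ (M.vert T),
    inner_corner_sub_corner_vert, mul_zero, sub_zero, ← hf.2, ← hf.2, hg, hg, inner_sub_right]
  ring

theorem IsP1.isPiecewiseAffine_grad (hf : M.IsP1 f val) : IsPiecewiseAffine (M.grad f) :=
  fun T => by
    obtain ⟨h, hh, -⟩ := hf.exists_grad_eq T
    exact ⟨AffineMap.const ℝ Space h, funext hh⟩

theorem IsP1.apply_sideMidpoint (hf : M.IsP1 f val) (T : D × Bool) (a : Fin 3) :
    f T (M.sideMidpoint T a) = (val (M.node T (a + 1)) + val (M.node T (a + 2))) / 2 := by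
  obtain ⟨g, c, hg⟩ := hf.1 T
  rw [← hf.2, ← hf.2, hg, hg, hg, sideMidpoint, sideVector, inner_add_right,
    real_inner_smul_right, inner_sub_right]
  ring

theorem IsP1.perp_grad (hf : M.IsP1 f val) : M.perp (M.grad f) = M.rtField (M.curlFlux val) := by
  funext T x
  obtain ⟨h, hh, hcorner⟩ := hf.exists_grad_eq T
  have tangential : inner ℝ (M.vert T) h = 0 := by
    rw [← hh x, real_inner_comm, inner_grad_vert]
  have flux_eq (a : Fin 3) : M.curlFlux val T a = inner ℝ (cross (M.vert T) h +
      (0 : ℝ) • (M.corner T (a + 1) - M.corner T 0)) (M.sideNormal T a) := by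
    rw [zero_smul, add_zero, sideNormal, ← neg_cross_eq_swap (M.vert T), inner_neg_right,
      inner_cross_cross, inner_vert_vert, tangential, sideVector, hcorner, curlFlux_apply]
    ring
  rw [M.rtField_eq_add_smul_sub (by rw [real_inner_comm, inner_cross_self_left]) flux_eq,
    zero_smul, add_zero, perp, hh]

theorem IsP1.inner_grad_add_mul_div (hf : M.IsP1 f val) (φ : Flux D) (T : D × Bool) :
    M.area T / 3 * ∑ a, (inner ℝ (M.grad f T (M.sideMidpoint T a))
        (M.rtField φ T (M.sideMidpoint T a)) +
      f T (M.sideMidpoint T a) * M.div (M.rtField φ) T (M.sideMidpoint T a)) =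
    ∑ a, φ T a * f T (M.sideMidpoint T a) := by
  obtain ⟨h, hh, hcorner⟩ := hf.exists_grad_eq T
  have increment (a b : Fin 3) : inner ℝ h (M.sideMidpoint T a - M.corner T b) =
      f T (M.sideMidpoint T a) - val (M.node T b) := by
    have midpoint_sub : M.sideMidpoint T a - M.corner T b =
        (2⁻¹ : ℝ) • (M.corner T (a + 1) - M.corner T b) +
          (2⁻¹ : ℝ) • (M.corner T (a + 2) - M.corner T b) := by
      rw [sideMidpoint, sideVector]
      module
    rw [midpoint_sub, inner_add_right, real_inner_smul_right, real_inner_smul_right, hcorner,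
      hcorner, hf.apply_sideMidpoint]
    ring
  have := (M.area_pos T).ne'
  simp only [hh, rtField_apply, div_rtField, real_inner_smul_right, inner_add_right, increment,
    hf.apply_sideMidpoint, norm_areaVector, Fin.sum_univ_three, Fin.reduceAdd, zero_add]
  field_simp
  ring

variable [Fintype D]

theorem innerVector_perp_perp {u : D × Bool → Space → Space}
    (hu : ∀ T x, inner ℝ (u T x) (M.vert T) = 0) (w : D × Bool → Space → Space) :
    M.innerVector (M.perp u) (M.perp w) = M.innerVector u w := by
  simp only [innerVector, perp, inner_cross_cross, inner_vert_vert, real_inner_comm _ (M.vert _),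
    hu, one_mul, zero_mul, sub_zero]

theorem IsP1.innerVector_grad (hf : M.IsP1 f val) {φ : Flux D} (hφ : φ ∈ M.conformingFlux) :
    M.innerVector (M.grad f) (M.rtField φ) = -M.innerScalar f (M.div (M.rtField φ)) := by
  rw [M.innerVector_eq_midpointForm hf.isPiecewiseAffine_grad (M.isPiecewiseAffine_rtField φ),
    M.innerScalar_eq_midpointForm hf.isPiecewiseAffine (M.isPiecewiseAffine_div_rtField φ),
    eq_neg_iff_add_eq_zero, midpointForm_apply, midpointForm_apply, ← Finset.sum_add_distrib]
  calc _ = ∑ T, ∑ a, φ T a * f T (M.sideMidpoint T a) := by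
        refine Finset.sum_congr rfl fun T _ => ?_
        rw [← hf.inner_grad_add_mul_div, Finset.sum_add_distrib, mul_add]
        rfl
    _ = 0 := M.sum_eq_zero_of_glue fun T a => by
        simp only [hf.apply_sideMidpoint, node_glue_add_one, node_glue_add_two]
        linear_combination (val (M.node T (a + 1)) + val (M.node T (a + 2))) / 2 * hφ T a

end PiecewiseLinear

section HarmonicFlux

/-- The nodal values of the P1 fields that vanish on the boundaries of all cells. -/
def interiorValues : Submodule ℝ (V ⊕ (E ⊕ C) → ℝ) where
  carrier := {val | (∀ j, val (Sum.inl j) = 0) ∧ ∀ e, val (Sum.inr (Sum.inl e)) = 0}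
  add_mem' hval hval' := ⟨fun j => by simp [hval.1 j, hval'.1 j], fun e => by
    simp [hval.2 e, hval'.2 e]⟩
  zero_mem' := ⟨fun _ => rfl, fun _ => rfl⟩
  smul_mem' c _ hval := ⟨fun j => by simp [hval.1 j], fun e => by simp [hval.2 e]⟩

/-- The fluxes of the rotated gradients of the interior P1 fields. -/
def bubbleFlux : Submodule ℝ (Flux D) := interiorValues.map M.curlFlux

theorem curlFlux_of_mem_interiorValues {val : V ⊕ (E ⊕ C) → ℝ} (hval : val ∈ interiorValues)
    (T : D × Bool) : M.curlFlux val T =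
      ![0, -val (Sum.inr (Sum.inr (M.cell T.1))), val (Sum.inr (Sum.inr (M.cell T.1)))] := by
  obtain ⟨d, _ | _⟩ := T <;> ext a <;> fin_cases a <;>
    simp [curlFlux_apply, node, hval.1, hval.2]

theorem mem_bubbleFlux_iff {φ : Flux D} : φ ∈ M.bubbleFlux ↔
    φ ∈ M.conformingFlux ∧ (∀ T, φ T 0 = 0) ∧ ∀ T, ∑ a, φ T a = 0 := by
  constructor
  · rintro ⟨val, hval, rfl⟩
    refine ⟨M.curlFlux_mem_conformingFlux val, fun T => ?_, M.sum_curlFlux val⟩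
    rw [M.curlFlux_of_mem_interiorValues hval T, Matrix.cons_val_zero]
  · rintro ⟨hφ, h_zero, h_sum⟩
    have opposite (T : D × Bool) : φ T 1 = -φ T 2 := by
      have := h_sum T
      rw [Fin.sum_univ_three, h_zero] at this
      linarith
    have invariant (T : D × Bool) : φ (M.turn T) 2 = φ T 2 := by
      have := hφ T 1
      rw [glue_one, opposite] at this
      linarith
    obtain ⟨l, hl⟩ := M.exists_eq_comp_cell (g := fun T => φ T 2) invariant
    have h_mem : Sum.elim (fun _ => 0) (Sum.elim (fun _ => 0) l) ∈
        interiorValues (V := V) (E := E) :=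
      ⟨fun _ => rfl, fun _ => rfl⟩
    refine ⟨_, h_mem, funext fun T => ?_⟩
    rw [M.curlFlux_of_mem_interiorValues h_mem]
    ext a
    fin_cases a <;> simp [h_zero, opposite, hl]

/-- The fluxes whose density is constant along each edge. -/
def edgeUniformFlux : Submodule ℝ (Flux D) where
  carrier := {φ | ∀ e, ∃ κ : ℝ, ∀ s, φ (M.pos e, s) 0 = κ * ‖M.sideVector (M.pos e, s) 0‖}
  add_mem' hφ hψ e := by
    obtain ⟨⟨κ, hκ⟩, κ', hκ'⟩ := hφ e, hψ e
    exact ⟨κ + κ', fun s => by simp only [Pi.add_apply, hκ, hκ', add_mul]⟩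
  zero_mem' e := ⟨0, fun s => by simp⟩
  smul_mem' c φ hφ e := by
    obtain ⟨κ, hκ⟩ := hφ e
    exact ⟨c * κ, fun s => by simp only [Pi.smul_apply, smul_eq_mul, hκ, mul_assoc]⟩

/-- The fluxes whose divergence is constant on each cell. -/
def cellUniformFlux : Submodule ℝ (Flux D) where
  carrier := {φ | ∃ δ : C → ℝ, ∀ T, ∑ a, φ T a = δ (M.cell T.1) * M.area T}
  add_mem' := by
    rintro φ ψ ⟨δ, hδ⟩ ⟨δ', hδ'⟩
    exact ⟨δ + δ', fun T => by
      simp only [Pi.add_apply, Finset.sum_add_distrib, hδ, hδ', add_mul]⟩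
  zero_mem' := ⟨0, fun T => by simp⟩
  smul_mem' := by
    rintro c φ ⟨δ, hδ⟩
    exact ⟨c • δ, fun T => by
      simp only [Pi.smul_apply, smul_eq_mul, ← Finset.mul_sum, hδ, mul_assoc]⟩

variable [Fintype D]

/-- The `L²` inner product of the Raviart-Thomas fields with given fluxes. -/
def fluxForm : LinearMap.BilinForm ℝ (Flux D) :=
  (M.midpointForm Space).compl₁₂ M.rtField M.rtField

theorem innerVector_rtField (φ ψ : Flux D) :
    M.innerVector (M.rtField φ) (M.rtField ψ) = M.fluxForm φ ψ :=
  M.innerVector_eq_midpointForm (M.isPiecewiseAffine_rtField φ) (M.isPiecewiseAffine_rtField ψ)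

theorem fluxForm_isSymm : M.fluxForm.IsSymm :=
  ⟨fun φ ψ => by simp only [← innerVector_rtField, innerVector, real_inner_comm]⟩

theorem eq_zero_of_fluxForm_self_eq_zero {φ : Flux D} (h : M.fluxForm φ φ = 0) : φ = 0 := by
  rw [fluxForm, LinearMap.compl₁₂_apply, midpointForm_apply] at h
  have third_pos (T : D × Bool) : 0 < M.area T / 3 := div_pos (M.area_pos T) three_pos
  have sum_nonneg (T : D × Bool) : 0 ≤ ∑ a, inner ℝ (M.rtField φ T (M.sideMidpoint T a))
      (M.rtField φ T (M.sideMidpoint T a)) := Finset.sum_nonneg fun _ _ => real_inner_self_nonneg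
  funext T a
  have h_triangle := (Finset.sum_eq_zero_iff_of_nonneg fun T _ =>
    mul_nonneg (third_pos T).le (sum_nonneg T)).mp h T (Finset.mem_univ T)
  have h_midpoint : M.rtField φ T (M.sideMidpoint T a) = 0 := inner_self_eq_zero.mp <|
    (Finset.sum_eq_zero_iff_of_nonneg fun _ _ => real_inner_self_nonneg).mp
      ((mul_eq_zero_iff_left (third_pos T).ne').mp h_triangle) a (Finset.mem_univ a)
  rw [← M.inner_rtField_sideNormal φ T a 2⁻¹, ← sideMidpoint, h_midpoint, inner_zero_left,
    Pi.zero_apply, Pi.zero_apply]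

/-- The harmonic fluxes: those of the RT0 fields with constant normal component along each edge that
are discrete harmonic extensions into the cells. They contain the fluxes of the velocity basis
functions and of the rotated gradients of the vertex basis functions. -/
def harmonicFlux : Submodule ℝ (Flux D) :=
  M.conformingFlux ⊓ M.edgeUniformFlux ⊓ M.cellUniformFlux ⊓ M.fluxForm.orthogonal M.bubbleFlux

end HarmonicFlux

section EdgeFluxes

theorem exists_antisymm_extension (σ : E → ℝ) :
    ∃ h : D → ℝ, (∀ d, h (M.rev d) = -h d) ∧ ∀ e, h (M.pos e) = σ e := by
  classical
  have pos_edge_rev (d : D) : M.pos (M.edge d) = M.rev d ↔ M.pos (M.edge d) ≠ d := by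
    rcases (M.edge_eq_iff d _).mp (M.edge_pos _).symm with h | h <;> rw [h]
    · simp [(M.rev_ne d).symm]
    · simp [M.rev_ne d]
  refine ⟨fun d => if M.pos (M.edge d) = d then σ (M.edge d) else -σ (M.edge d), fun d => ?_,
    fun e => by simp [M.edge_pos]⟩
  by_cases h : M.pos (M.edge d) = d <;> simp only [edge_rev, pos_edge_rev] <;> simp [h]

theorem eq_zero_of_antisymm {h : D → ℝ} (hrev : ∀ d, h (M.rev d) = -h d)
    (hpos : ∀ e, h (M.pos e) = 0) (d : D) : h d = 0 := by
  rcases (M.edge_eq_iff d _).mp (M.edge_pos _).symm with hd | hd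
  · rw [← hd, hpos]
  · rw [← neg_eq_zero, ← hrev, ← hd, hpos]

theorem dartFlux_rev {φ : Flux D} (hφ : φ ∈ M.conformingFlux) (d : D) :
    dartFlux φ (M.rev d) = -dartFlux φ d := by
  have first : φ (d, false) 0 + φ (M.rev d, true) 0 = 0 := hφ (d, false) 0
  have second : φ (d, true) 0 + φ (M.rev d, false) 0 = 0 := hφ (d, true) 0
  rw [dartFlux_apply, dartFlux_apply]
  linarith

/-- The length of the primal edge of a dart, as a polygonal line through the edge point. -/
def edgeLength (d : D) : ℝ := ∑ s, ‖M.sideVector (d, s) 0‖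

theorem edgeLength_pos (d : D) : 0 < M.edgeLength d :=
  Finset.sum_pos (fun _ _ => M.norm_sideVector_pos _ _) Finset.univ_nonempty

theorem norm_sideVector_rev (d : D) (s : Bool) :
    ‖M.sideVector (M.rev d, s) 0‖ = ‖M.sideVector (d, !s) 0‖ := by
  rw [← norm_neg (M.sideVector (d, !s) 0), ← sideVector_glue]
  cases s <;> rfl

theorem edgeLength_rev (d : D) : M.edgeLength (M.rev d) = M.edgeLength d := by
  simp only [edgeLength, norm_sideVector_rev, Fintype.sum_bool, Bool.not_true, Bool.not_false,
    add_comm]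

theorem outerFlux_eq_zero_of_dartFlux_eq_zero {φ : Flux D} (hφ : φ ∈ M.conformingFlux)
    (huniform : φ ∈ M.edgeUniformFlux) (h : ∀ e, dartFlux φ (M.pos e) = 0) (T : D × Bool) :
    φ T 0 = 0 := by
  have on_pos (e : E) (s : Bool) : φ (M.pos e, s) 0 = 0 := by
    obtain ⟨κ, hκ⟩ := huniform e
    have total : κ * M.edgeLength (M.pos e) = 0 := by
      rw [← h e, dartFlux_apply, hκ, hκ, edgeLength, Fintype.sum_bool]
      ring
    rw [hκ, (mul_eq_zero_iff_right (M.edgeLength_pos _).ne').mp total, zero_mul]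
  obtain ⟨d, s⟩ := T
  rcases (M.edge_eq_iff d _).mp (M.edge_pos _).symm with hd | hd
  · rw [← hd, on_pos]
  · have := hφ (M.pos (M.edge d), !s) 0
    rw [on_pos, zero_add, hd] at this
    cases s <;> simpa [glue, M.rev_rev] using this

variable [Fintype D] [DecidableEq C]

theorem cellArea_pos (i : C) : 0 < M.cellArea i := by
  obtain ⟨d, hd⟩ := M.cell_surjective i
  refine Finset.sum_pos' (fun T _ => ?_) ⟨(d, false), Finset.mem_univ _, ?_⟩
  · split_ifs
    exacts [(M.area_pos T).le, le_rfl]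
  · rw [if_pos hd]
    exact M.area_pos _

theorem sum_cell_eq_sum_darts (f : D × Bool → ℝ) (i : C) :
    ∑ T, (if M.cell T.1 = i then f T else 0) =
      ∑ d with M.cell d = i, (f (d, false) + f (d, true)) := by
  rw [Fintype.sum_prod_type, Finset.sum_filter]
  refine Finset.sum_congr rfl fun d _ => ?_
  rw [Fintype.sum_bool]
  split_ifs <;> ring

theorem sum_cell_turn (f : D × Bool → ℝ) (i : C) :
    ∑ T, (if M.cell T.1 = i then f (M.turn T) else 0) =
      ∑ T, if M.cell T.1 = i then f T else 0 := by
  rw [← Equiv.sum_comp M.turn fun T => if M.cell T.1 = i then f T else 0]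
  simp only [cell_turn]

theorem sum_cell_sum_flux {φ : Flux D} (hφ : φ ∈ M.conformingFlux) (i : C) :
    ∑ T, (if M.cell T.1 = i then ∑ a, φ T a else 0) =
      ∑ d with M.cell d = i, dartFlux φ d := by
  have cancel (T : D × Bool) : φ T 1 = -φ (M.turn T) 2 := by
    have := hφ T 1
    rw [glue_one] at this
    linarith
  calc _ = ∑ T, (if M.cell T.1 = i then φ T 0 else 0) +
        (∑ T, (if M.cell T.1 = i then φ T 2 else 0) -
          ∑ T, if M.cell T.1 = i then φ (M.turn T) 2 else 0) := by
        rw [← Finset.sum_sub_distrib, ← Finset.sum_add_distrib]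
        refine Finset.sum_congr rfl fun T _ => ?_
        rw [Fin.sum_univ_three, cancel]
        split_ifs <;> ring
    _ = _ := by
        rw [M.sum_cell_turn fun T => φ T 2, sub_self, add_zero, sum_cell_eq_sum_darts]
        rfl

theorem cellUniformFlux_density {φ : Flux D} (hφ : φ ∈ M.conformingFlux) {δ : C → ℝ}
    (hδ : ∀ T, ∑ a, φ T a = δ (M.cell T.1) * M.area T) (i : C) :
    δ i * M.cellArea i = ∑ d with M.cell d = i, dartFlux φ d := by
  rw [← M.sum_cell_sum_flux hφ, cellArea, Finset.mul_sum]
  refine Finset.sum_congr rfl fun T _ => ?_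
  split_ifs with hT
  · rw [hδ, hT]
  · rw [mul_zero]

theorem exists_conformingFlux_of_outerFlux {outer : D × Bool → ℝ} {δ : C → ℝ}
    (hglue : ∀ d, outer (d, false) + outer (M.rev d, true) = 0)
    (hδ : ∀ i, δ i * M.cellArea i = ∑ T, if M.cell T.1 = i then outer T else 0) :
    ∃ φ ∈ M.conformingFlux, (∀ T, φ T 0 = outer T) ∧
      ∀ T, ∑ a, φ T a = δ (M.cell T.1) * M.area T := by
  cases @nonempty_fintype C (Finite.of_surjective M.cell M.cell_surjective)
  obtain ⟨f, hf⟩ := exists_sub_comp_symm_eq M.turn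
    (fun T => δ (M.cell T.1) * M.area T - outer T) fun g hg => by
      obtain ⟨g', hg'⟩ := M.exists_eq_comp_cell hg
      rw [dotProduct, ← Finset.sum_fiberwise Finset.univ fun T : D × Bool => M.cell T.1]
      refine Finset.sum_eq_zero fun i _ => ?_
      calc _ = ∑ T with M.cell T.1 = i, g' i * (δ i * M.area T - outer T) :=
            Finset.sum_congr rfl fun T hT => by rw [hg', (Finset.mem_filter.mp hT).2]
        _ = g' i * (δ i * M.cellArea i - ∑ T, if M.cell T.1 = i then outer T else 0) := by
            rw [← Finset.mul_sum, Finset.sum_sub_distrib, ← Finset.mul_sum, Finset.sum_filter,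
              Finset.sum_filter, cellArea]
        _ = 0 := by rw [hδ, sub_self, mul_zero]
  refine ⟨fun T => ![outer T, f T, -f (M.turn.symm T)], fun T a => ?_, fun _ => rfl, fun T => ?_⟩
  · fin_cases a
    · obtain ⟨d, _ | _⟩ := T
      · exact hglue d
      · have := hglue (M.rev d)
        rw [M.rev_rev, add_comm] at this
        exact this
    · simp [glue_one]
    · simp [glue_two]
  · rw [Fin.sum_univ_three]
    simp only [Matrix.cons_val]
    linarith [hf T]

end EdgeFluxes

section HarmonicExtension

variable [Fintype D]

theorem eq_zero_of_mem_harmonicFlux {φ : Flux D} (hφ : φ ∈ M.harmonicFlux)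
    (h : ∀ e, dartFlux φ (M.pos e) = 0) : φ = 0 := by
  classical
  obtain ⟨⟨⟨h_conforming, h_edge⟩, δ, hδ⟩, h_orthogonal⟩ := hφ
  have dartFlux_eq_zero := M.eq_zero_of_antisymm (M.dartFlux_rev h_conforming) h
  have density_eq_zero (i : C) : δ i = 0 := by
    have := M.cellUniformFlux_density h_conforming hδ i
    rw [Finset.sum_eq_zero fun d _ => dartFlux_eq_zero d] at this
    exact (mul_eq_zero_iff_right (M.cellArea_pos i).ne').mp this
  have h_bubble : φ ∈ M.bubbleFlux := M.mem_bubbleFlux_iff.mpr ⟨h_conforming,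
    M.outerFlux_eq_zero_of_dartFlux_eq_zero h_conforming h_edge h,
    fun T => by rw [hδ, density_eq_zero, zero_mul]⟩
  exact M.eq_zero_of_fluxForm_self_eq_zero (h_orthogonal φ h_bubble)

theorem exists_add_mem_orthogonal_bubbleFlux (φ : Flux D) :
    ∃ w ∈ M.bubbleFlux, φ + w ∈ M.fluxForm.orthogonal M.bubbleFlux :=
  exists_mem_add_mem_orthogonal M.fluxForm_isSymm.isRefl
    (fun _ => M.eq_zero_of_fluxForm_self_eq_zero) M.bubbleFlux φ

theorem exists_mem_harmonicFlux (σ : E → ℝ) :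
    ∃ φ ∈ M.harmonicFlux, ∀ e, dartFlux φ (M.pos e) = σ e := by
  classical
  obtain ⟨h, hrev, hpos⟩ := M.exists_antisymm_extension σ
  let outer (T : D × Bool) : ℝ := h T.1 / M.edgeLength T.1 * ‖M.sideVector T 0‖
  let density (i : C) : ℝ := (∑ d with M.cell d = i, h d) / M.cellArea i
  have outer_add (d : D) : outer (d, false) + outer (d, true) = h d := by
    have := (M.edgeLength_pos d).ne'
    rw [← mul_add, add_comm ‖_‖, ← Fintype.sum_bool fun s => ‖M.sideVector (d, s) 0‖,
      ← edgeLength]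
    field_simp
  have outer_glue (d : D) : outer (d, false) + outer (M.rev d, true) = 0 := by
    simp only [outer, hrev, edgeLength_rev, norm_sideVector_rev, Bool.not_true]
    ring
  obtain ⟨φ, h_conforming, h_outer, h_cell⟩ := M.exists_conformingFlux_of_outerFlux
    (δ := density) outer_glue fun i => by
      rw [div_mul_cancel₀ _ (M.cellArea_pos i).ne', sum_cell_eq_sum_darts]
      simp only [outer_add]
  obtain ⟨w, hw, h_orthogonal⟩ := M.exists_add_mem_orthogonal_bubbleFlux φ
  obtain ⟨w_conforming, w_outer, w_sum⟩ := M.mem_bubbleFlux_iff.mp hw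
  have outer_eq (T : D × Bool) : (φ + w) T 0 = outer T := by
    rw [Pi.add_apply, Pi.add_apply, w_outer, add_zero, h_outer]
  refine ⟨φ + w, ⟨⟨⟨add_mem h_conforming w_conforming, ?_⟩, ⟨density, fun T => ?_⟩⟩, h_orthogonal⟩,
    fun e => ?_⟩
  · exact fun e => ⟨h (M.pos e) / M.edgeLength (M.pos e), fun s => outer_eq (M.pos e, s)⟩
  · simp only [Pi.add_apply, Finset.sum_add_distrib, w_sum, add_zero, h_cell]
  · rw [dartFlux_apply, outer_eq, outer_eq, outer_add, hpos]

end HarmonicExtension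

section BasisFunctions

theorem dartFlux_curlFlux (val : V ⊕ (E ⊕ C) → ℝ) (d : D) :
    dartFlux (M.curlFlux val) d =
      val (Sum.inl (M.orig d)) - val (Sum.inl (M.orig (M.rev d))) := by
  simp [dartFlux_apply, curlFlux_apply, node]

theorem norm_sideVector_false (d : D) :
    ‖M.sideVector (d, false) 0‖ = dist (M.xV (M.orig d)) (M.xE (M.edge d)) :=
  (dist_eq_norm' _ _).symm

theorem norm_sideVector_true (d : D) :
    ‖M.sideVector (d, true) 0‖ = dist (M.xE (M.edge d)) (M.xV (M.orig (M.rev d))) :=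
  (dist_eq_norm' _ _).symm

theorem exists_edge_interpolation (v : V → ℝ) :
    ∃ (w : E → ℝ) (slope : D → ℝ), ∀ d,
      w (M.edge d) - v (M.orig d) = slope d * dist (M.xV (M.orig d)) (M.xE (M.edge d)) ∧
      v (M.orig (M.rev d)) - w (M.edge d) =
        slope d * dist (M.xE (M.edge d)) (M.xV (M.orig (M.rev d))) := by
  let slope (d : D) : ℝ := (v (M.orig (M.rev d)) - v (M.orig d)) / M.edgeLength d
  let interpolant (d : D) : ℝ := v (M.orig d) + slope d * ‖M.sideVector (d, false) 0‖
  have slope_rev (d : D) : slope (M.rev d) = -slope d := by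
    simp only [slope, M.rev_rev, edgeLength_rev]
    ring
  have second_half (d : D) : v (M.orig (M.rev d)) - interpolant d =
      slope d * ‖M.sideVector (d, true) 0‖ := by
    have total : slope d * M.edgeLength d = v (M.orig (M.rev d)) - v (M.orig d) :=
      div_mul_cancel₀ _ (M.edgeLength_pos d).ne'
    rw [edgeLength, Fintype.sum_bool] at total
    simp only [interpolant]
    linarith
  have interpolant_rev (d : D) : interpolant (M.rev d) = interpolant d := by
    have := second_half d
    simp only [interpolant, slope_rev, norm_sideVector_rev, Bool.not_false] at this ⊢
    linarith
  have interpolant_pos (d : D) : interpolant (M.pos (M.edge d)) = interpolant d := by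
    rcases (M.edge_eq_iff d _).mp (M.edge_pos _).symm with h | h <;> rw [h]
    exact interpolant_rev d
  refine ⟨fun e => interpolant (M.pos e), slope, fun d => ?_⟩
  simp only [interpolant_pos, ← norm_sideVector_false, ← norm_sideVector_true]
  exact ⟨add_sub_cancel_left _ _, second_half d⟩

theorem mem_edgeUniformFlux_iff {φ : Flux D} : φ ∈ M.edgeUniformFlux ↔
    ∀ e, ∃ c : ℝ, ∀ s, ∀ x ∈ M.side (M.pos e, s) 0,
      inner ℝ (M.rtField φ (M.pos e, s) x) (M.outNormal (M.pos e, s) 0) = c := by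
  refine forall_congr' fun e => exists_congr fun c => forall_congr' fun s => ?_
  have corner_mem : M.corner (M.pos e, s) (0 + 1) ∈ M.side (M.pos e, s) 0 :=
    left_mem_segment ℝ _ _
  rw [← div_eq_iff (M.norm_sideVector_pos (M.pos e, s) 0).ne']
  exact ⟨fun h x hx => (M.inner_rtField_outNormal φ hx).trans h,
    fun h => (M.inner_rtField_outNormal φ corner_mem).symm.trans (h _ corner_mem)⟩

theorem mem_cellUniformFlux_iff {φ : Flux D} : φ ∈ M.cellUniformFlux ↔
    ∃ δ : C → ℝ, ∀ T x, M.div (M.rtField φ) T x = δ (M.cell T.1) :=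
  exists_congr fun δ => forall_congr' fun T => by
    simp only [div_rtField, div_eq_iff (M.area_pos T).ne', forall_const]

variable [Fintype D]

theorem mem_orthogonal_bubbleFlux_iff {φ : Flux D} :
    φ ∈ M.fluxForm.orthogonal M.bubbleFlux ↔
      ∀ g, M.IsInteriorP1 g → M.innerVector (M.rtField φ) (M.perp (M.grad g)) = 0 := by
  rw [LinearMap.BilinForm.mem_orthogonal_iff]
  constructor
  · rintro h g ⟨val, hg, hval⟩
    rw [hg.perp_grad, innerVector_rtField]
    exact M.fluxForm_isSymm.isRefl _ _ (h _ ⟨val, hval, rfl⟩)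
  · rintro h _ ⟨val, hval, rfl⟩
    apply M.fluxForm_isSymm.isRefl
    rw [← innerVector_rtField, ← (M.isP1_p1Field val).perp_grad]
    exact h _ ⟨val, M.isP1_p1Field val, hval⟩

theorem isVelocityBasis_rtField_iff [DecidableEq E] {φ : Flux D} {e : E} :
    M.IsVelocityBasis e (M.rtField φ) ↔
      φ ∈ M.harmonicFlux ∧ ∀ e', dartFlux φ (M.pos e') = if e' = e then 1 else 0 := by
  simp only [IsVelocityBasis, harmonicFlux, Submodule.mem_inf, isRT0_rtField_iff,
    mem_edgeUniformFlux_iff, mem_cellUniformFlux_iff, mem_orthogonal_bubbleFlux_iff,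
    edgeFlux_rtField]
  tauto

theorem exists_isVelocityBasis [DecidableEq E] (e : E) : ∃ u, M.IsVelocityBasis e u := by
  obtain ⟨φ, hφ, hdart⟩ := M.exists_mem_harmonicFlux fun e' => if e' = e then 1 else 0
  exact ⟨M.rtField φ, M.isVelocityBasis_rtField_iff.mpr ⟨hφ, hdart⟩⟩

theorem IsVelocityBasis.exists_harmonicFlux [DecidableEq E] {M : PolygonalMesh D V E C} {e : E}
    {u : D × Bool → Space → Space} (hu : M.IsVelocityBasis e u) :
    ∃ φ ∈ M.harmonicFlux, u = M.rtField φ ∧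
      ∀ e', dartFlux φ (M.pos e') = if e' = e then 1 else 0 := by
  obtain ⟨φ, -, rfl⟩ := hu.1.exists_eq_rtField
  obtain ⟨hφ, hdart⟩ := M.isVelocityBasis_rtField_iff.mp hu
  exact ⟨φ, hφ, rfl, hdart⟩

theorem IsP1.innerVector_grad_grad {M : PolygonalMesh D V E C} {f : D × Bool → Space → ℝ}
    {val : V ⊕ (E ⊕ C) → ℝ} (hf : M.IsP1 f val) (g : D × Bool → Space → ℝ) :
    M.innerVector (M.grad f) (M.grad g) =
      M.innerVector (M.rtField (M.curlFlux val)) (M.perp (M.grad g)) := by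
  rw [← hf.perp_grad, innerVector_perp_perp (M.inner_grad_vert f)]

variable [DecidableEq V]

theorem exists_isGamma (j : V) : ∃ f, M.IsGamma j f := by
  let vertexValue (j' : V) : ℝ := if j' = j then 1 else 0
  obtain ⟨edgeValue, slope, hslope⟩ := M.exists_edge_interpolation vertexValue
  let val₀ : V ⊕ (E ⊕ C) → ℝ := Sum.elim vertexValue (Sum.elim edgeValue fun _ => 0)
  obtain ⟨_, ⟨bubble, ⟨bubble_vertex, bubble_edge⟩, rfl⟩, h_orthogonal⟩ :=
    M.exists_add_mem_orthogonal_bubbleFlux (M.curlFlux val₀)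
  rw [← map_add, mem_orthogonal_bubbleFlux_iff] at h_orthogonal
  have hf := M.isP1_p1Field (val₀ + bubble)
  refine ⟨_, _, hf, fun j' => ?_, fun d => ⟨slope d, ?_⟩, fun g hg => ?_⟩
  · simp [val₀, vertexValue, bubble_vertex]
  · simpa [val₀, bubble_vertex, bubble_edge] using hslope d
  · rw [hf.innerVector_grad_grad, h_orthogonal g hg]

theorem IsGamma.exists_curlFlux_mem_harmonicFlux {M : PolygonalMesh D V E C} {j : V}
    {f : D × Bool → Space → ℝ} (hf : M.IsGamma j f) :
    ∃ val, M.IsP1 f val ∧ M.curlFlux val ∈ M.harmonicFlux ∧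
      ∀ e, dartFlux (M.curlFlux val) (M.pos e) = -M.D₁ e j := by
  obtain ⟨val, hval, h_vertex, h_slope, h_harmonic⟩ := hf
  refine ⟨val, hval, ⟨⟨⟨M.curlFlux_mem_conformingFlux val, fun e => ?_⟩, 0, fun T => ?_⟩, ?_⟩,
    fun e => ?_⟩
  · obtain ⟨slope, h_first, h_second⟩ := h_slope (M.pos e)
    refine ⟨-slope, Bool.rec ?_ ?_⟩
    · rw [norm_sideVector_false, neg_mul, ← h_first, neg_sub]
      rfl
    · rw [norm_sideVector_true, neg_mul, ← h_second, neg_sub]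
      rfl
  · rw [sum_curlFlux, Pi.zero_apply, zero_mul]
  · refine M.mem_orthogonal_bubbleFlux_iff.mpr fun g hg => ?_
    rw [← hval.innerVector_grad_grad, h_harmonic g hg]
  · rw [dartFlux_curlFlux, h_vertex, h_vertex, D₁_apply, neg_sub]

end BasisFunctions

section Coriolis

theorem IsPiecewiseAffine.perp {u : D × Bool → Space → Space} (hu : IsPiecewiseAffine u) :
    IsPiecewiseAffine (M.perp u) := fun T => by
  obtain ⟨L, hL⟩ := hu T
  let crossVert : Space →ₗ[ℝ] Space :=
    { toFun := cross (M.vert T)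
      map_add' := cross_add _
      map_smul' := fun c w => cross_smul c _ w }
  exact ⟨crossVert.toAffineMap.comp L, funext fun x => congrArg (cross (M.vert T)) (congrFun hL x)⟩

variable [Fintype D]

theorem innerVector_perp_comm (u w : D × Bool → Space → Space) :
    M.innerVector u (M.perp w) = -M.innerVector w (M.perp u) := by
  simp only [innerVector, integral, triIntegral, perp]
  rw [← Finset.sum_neg_distrib]
  refine Finset.sum_congr rfl fun T _ => ?_
  rw [← mul_neg, ← intervalIntegral.integral_neg]
  simp only [← intervalIntegral.integral_neg, ← inner_cross_swap]

theorem W_transpose (v : E → D × Bool → Space → Space) : (M.W v).transpose = -M.W v := by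
  ext e e'
  exact congrArg Neg.neg (M.innerVector_perp_comm _ _)

theorem isPiecewiseAffine_alpha [DecidableEq C] (i : C) : IsPiecewiseAffine (M.alpha i) :=
  fun _ => ⟨AffineMap.const ℝ Space _, rfl⟩

variable {M} [DecidableEq E]

theorem IsVelocityBasis.isPiecewiseAffine {e : E} {u : D × Bool → Space → Space}
    (hu : M.IsVelocityBasis e u) : IsPiecewiseAffine u := by
  obtain ⟨φ, -, rfl, -⟩ := hu.exists_harmonicFlux
  exact M.isPiecewiseAffine_rtField φ

theorem IsVelocityBasis.div_eq [Fintype C] [DecidableEq C] {e : E}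
    {u : D × Bool → Space → Space} (hu : M.IsVelocityBasis e u) :
    M.div u = ∑ i, M.D₂ i e • M.alpha i := by
  cases @nonempty_fintype E (Finite.of_surjective M.edge fun e' => ⟨M.pos e', M.edge_pos e'⟩)
  obtain ⟨φ, ⟨⟨⟨h_conforming, -⟩, δ, hδ⟩, -⟩, rfl, h_dart⟩ := hu.exists_harmonicFlux
  have density (i : C) : δ i * M.cellArea i = M.D₂ i e := by
    rw [M.cellUniformFlux_density h_conforming hδ,
      ← M.sum_D₂_mul (M.dartFlux_rev h_conforming) i]
    simp [h_dart]
  funext T x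
  have := (M.cellArea_pos (M.cell T.1)).ne'
  rw [div_rtField, hδ, mul_div_cancel_right₀ _ (M.area_pos T).ne']
  simp only [Finset.sum_apply, Pi.smul_apply, alpha, smul_eq_mul, mul_ite, mul_zero,
    Finset.sum_ite_eq, Finset.mem_univ, if_true, ← density]
  field_simp

theorem IsGamma.innerVector_grad [Fintype C] [DecidableEq V] [DecidableEq C] {j : V} {e : E}
    {f : D × Bool → Space → ℝ} (hf : M.IsGamma j f) {u : D × Bool → Space → Space}
    (hu : M.IsVelocityBasis e u) :
    M.innerVector (M.grad f) u = -∑ i, M.innerScalar f (M.alpha i) * M.D₂ i e := by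
  have div_eq := hu.div_eq
  obtain ⟨val, hval, -⟩ := hf
  obtain ⟨φ, h_conforming, rfl⟩ := hu.1.exists_eq_rtField
  rw [hval.innerVector_grad h_conforming, M.innerScalar_eq_midpointForm hval.isPiecewiseAffine
    (M.isPiecewiseAffine_div_rtField φ), div_eq]
  simp only [map_sum, map_smul, LinearMap.sum_apply, LinearMap.smul_apply, smul_eq_mul,
    M.innerScalar_eq_midpointForm hval.isPiecewiseAffine (M.isPiecewiseAffine_alpha _), mul_comm]

variable [Fintype E]

theorem IsGamma.perp_grad [DecidableEq V] {j : V} {f : D × Bool → Space → ℝ} (hf : M.IsGamma j f)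
    {v : E → D × Bool → Space → Space} (hv : ∀ e, M.IsVelocityBasis e (v e)) :
    M.perp (M.grad f) = -∑ e, M.D₁ e j • v e := by
  obtain ⟨val, hval, h_harmonic, h_dart⟩ := hf.exists_curlFlux_mem_harmonicFlux
  choose φ hφ hvφ hφ_dart using fun e => (hv e).exists_harmonicFlux
  have h_zero : M.curlFlux val + ∑ e, M.D₁ e j • φ e = 0 := by
    refine M.eq_zero_of_mem_harmonicFlux
      (add_mem h_harmonic (sum_mem fun e _ => Submodule.smul_mem _ _ (hφ e))) fun e' => ?_
    simp [h_dart, hφ_dart]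
  rw [hval.perp_grad, eq_neg_of_add_eq_zero_left h_zero, map_neg, map_sum]
  simp only [map_smul, hvφ]

theorem IsGamma.innerVector_perp_grad_perp [DecidableEq V] {j : V} {f : D × Bool → Space → ℝ}
    (hf : M.IsGamma j f) {v : E → D × Bool → Space → Space}
    (hv : ∀ e, M.IsVelocityBasis e (v e)) (e' : E) :
    M.innerVector (M.perp (M.grad f)) (M.perp (v e')) =
      -∑ e, M.D₁ e j * M.innerVector (v e) (M.perp (v e')) := by
  have h_grad : IsPiecewiseAffine (M.perp (M.grad f)) := by
    obtain ⟨val, hval, -⟩ := hf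
    exact hval.isPiecewiseAffine_grad.perp M
  rw [M.innerVector_eq_midpointForm h_grad ((hv e').isPiecewiseAffine.perp M), hf.perp_grad hv]
  simp only [map_neg, map_sum, map_smul, LinearMap.neg_apply, LinearMap.sum_apply,
    LinearMap.smul_apply, smul_eq_mul,
    M.innerVector_eq_midpointForm (hv _).isPiecewiseAffine ((hv e').isPiecewiseAffine.perp M)]

theorem neg_D₂bar_mul_W [Fintype C] [DecidableEq V] [DecidableEq C]
    {γ : V → D × Bool → Space → ℝ} {v : E → D × Bool → Space → Space}
    (hγ : ∀ j, M.IsGamma j (γ j)) (hv : ∀ e, M.IsVelocityBasis e (v e)) :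
    -(M.D₂bar * M.W v) = M.R γ * M.D₂ := by
  ext j e'
  calc (-(M.D₂bar * M.W v)) j e' = ∑ e, M.D₁ e j * M.innerVector (v e) (M.perp (v e')) := by
        simp [Matrix.mul_apply, D₂bar, W]
    _ = -M.innerVector (M.perp (M.grad (γ j))) (M.perp (v e')) := by
        rw [(hγ j).innerVector_perp_grad_perp hv, neg_neg]
    _ = -M.innerVector (M.grad (γ j)) (v e') := by
        rw [innerVector_perp_perp (M.inner_grad_vert (γ j))]
    _ = ∑ i, M.innerScalar (γ j) (M.alpha i) * M.D₂ i e' := by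
        rw [(hγ j).innerVector_grad (hv e'), neg_neg]
    _ = (M.R γ * M.D₂) j e' := by simp only [Matrix.mul_apply, R, Matrix.of_apply]

end Coriolis

end PolygonalMesh

end

theorem mainTheorem2 {D V E C : Type*} [Fintype D] [Fintype V] [Fintype E] [Fintype C]
    [DecidableEq V] [DecidableEq E] [DecidableEq C] (M : PolygonalMesh D V E C) :
    (∀ j : V, ∃ f : D × Bool → Space → ℝ, M.IsGamma j f) ∧
    (∀ e : E, ∃ u : D × Bool → Space → Space, M.IsVelocityBasis e u) ∧
    ∀ (γ : V → D × Bool → Space → ℝ) (v : E → D × Bool → Space → Space),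
      (∀ j, M.IsGamma j (γ j)) → (∀ e, M.IsVelocityBasis e (v e)) →
        (M.W v).transpose = -M.W v ∧
        -(M.D₂bar * M.W v) = M.R γ * M.D₂ ∧
        M.D₂bar * M.W v * M.D₁ = 0 := by
  refine ⟨M.exists_isGamma, M.exists_isVelocityBasis, fun γ v hγ hv => ?_⟩
  have h_curl_eq : -(M.D₂bar * M.W v) = M.R γ * M.D₂ := M.neg_D₂bar_mul_W hγ hv
  refine ⟨M.W_transpose v, h_curl_eq, ?_⟩
  rw [← neg_eq_zero, ← Matrix.neg_mul, h_curl_eq, Matrix.mul_assoc, M.D₂_mul_D₁, Matrix.mul_zero]
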